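/- Let $M$ be a smooth $n$-dimensional manifold, $\alpha=\sqrt{a_{ij}(x)y^iy^j}$ a smooth Riemannian metric and $\beta=b_i(x)y^i$ a smooth $1$-form on $M$. Consider the Kropina metric $F=\alpha^2/\beta$ on the set of tangent vectors $(x,y)$ with $\beta(x,y)>0$. In local coordinates put $g_{ij}=\tfrac12[F^2]_{y^iy^j}$, $G^i=\tfrac14 g^{il}\{[F^2]_{x^ky^l}y^k-[F^2]_{x^l}\}$, $$R^i{}_k=2\frac{\partial G^i}{\partial x^k}-y^m\frac{\partial^2G^i}{\partial x^m\partial y^k}+2G^m\frac{\partial^2G^i}{\partial y^m\partial y^k}-\frac{\partial G^i}{\partial y^m}\frac{\partial G^m}{\partial y^k},\qquad \mathrm{Ric}=R^m{}_m .$$ Let $\sigma_F(x)=\mathrm{Vol}(B^n(1))/\mathrm{Vol}\{y\in\mathbb R^n:\beta(x,y)>0,\ F(x,y)<1\}$ be the density of the Busemann–Hausdorff volume form and $\tau(x,y)=\ln\bigl(\sqrt{\det(g_{ij}(x,y))}/\sigma_F(x)\bigr)$ the distortion. The S-curvature at $(x,y)$ is $S(x,y)=\frac{d}{dt}\big|_{t=0}\tau(c(t),\dot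 c(t))$, where $c$ is the geodesic (the solution of $\ddot c^i+2G^i(c,\dot c)=0$) with $c(0)=x$, $\dot c(0)=y$. **Theorem.** If $F=\alpha^2/\beta$ is an Einstein metric, that is, if there is a function $\sigma=\sigma(x)$ on $M$ with $\mathrm{Ric}(x,y)=\sigma(x)F(x,y)^2$ for all $(x,y)$ with $\beta(x,y)>0$, then $S(x,y)=0$ for all $(x,y)$ with $\beta(x,y)>0$. -/

import Mathlib

open scoped Manifold ContDiff Bundle

noncomputable section

namespace Finsler

/-! ### Finsler geometry in a coordinate domain

`p = (x, y)` denotes a point `x` of a coordinate domain in `ℝⁿ` together with the components `y` of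
a tangent vector at `x`. A Finsler metric is given there by a function `F (x, y)`, considered on an
open set `D` of pairs `(x, y)` on which it is smooth. -/

/-- The coordinate space `ℝⁿ`. -/
abbrev Coord (n : ℕ) : Type := EuclideanSpace ℝ (Fin n)

section Local

variable {n : ℕ}

/-- The partial derivative `∂f/∂xⁱ`. -/
def dx (i : Fin n) (f : Coord n × Coord n → ℝ) (p : Coord n × Coord n) : ℝ :=
  fderiv ℝ f p (EuclideanSpace.single i 1, 0)

/-- The partial derivative `∂f/∂yⁱ`. -/
def dy (i : Fin n) (f : Coord n × Coord n → ℝ) (p : Coord n × Coord n) : ℝ :=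
  fderiv ℝ f p (0, EuclideanSpace.single i 1)

/-- The fundamental tensor `g_ij = ½ ∂²F²/∂yⁱ∂yʲ`. -/
def fundTensor (F : Coord n × Coord n → ℝ) (p : Coord n × Coord n) : Matrix (Fin n) (Fin n) ℝ :=
  Matrix.of fun i j => (1 / 2) * dy i (dy j fun q => F q ^ 2) p

/-- The geodesic coefficients `Gⁱ = ¼ gⁱˡ ([F²]_{xᵏyˡ} yᵏ - [F²]_{xˡ})`. -/
def geodCoeff (F : Coord n × Coord n → ℝ) (i : Fin n) (p : Coord n × Coord n) : ℝ :=
  (1 / 4) * ∑ l, (fundTensor F p)⁻¹ i l *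
    ((∑ k, dx k (dy l fun q => F q ^ 2) p * p.2 k) - dx l (fun q => F q ^ 2) p)

/-- The Riemann curvature
`Rⁱ_k = 2 ∂Gⁱ/∂xᵏ - yᵐ ∂²Gⁱ/∂xᵐ∂yᵏ + 2 Gᵐ ∂²Gⁱ/∂yᵐ∂yᵏ - ∂Gⁱ/∂yᵐ ∂Gᵐ/∂yᵏ`. -/
def riemannCurv (F : Coord n × Coord n → ℝ) (i k : Fin n) (p : Coord n × Coord n) : ℝ :=
  2 * dx k (geodCoeff F i) p
    - ∑ m, p.2 m * dx m (dy k (geodCoeff F i)) p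
    + 2 * ∑ m, geodCoeff F m p * dy m (dy k (geodCoeff F i)) p
    - ∑ m, dy m (geodCoeff F i) p * dy k (geodCoeff F m) p

/-- The Ricci curvature `Ric = Rᵐ_m`. -/
def ricciCurv (F : Coord n × Coord n → ℝ) (p : Coord n × Coord n) : ℝ :=
  ∑ m, riemannCurv F m m p

/-- The density `σ_F(x) = Vol(Bⁿ(1)) / Vol {y | F(x, y) < 1}` of the Busemann–Hausdorff volume form
with respect to the coordinates; `y` runs over the vectors at which `F` is considered. -/
def bhDensity (D : Set (Coord n × Coord n)) (F : Coord n × Coord n → ℝ) (x : Coord n) : ℝ :=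
  (MeasureTheory.volume (Metric.ball (0 : Coord n) 1)).toReal /
    (MeasureTheory.volume {y : Coord n | (x, y) ∈ D ∧ F (x, y) < 1}).toReal

/-- The distortion `τ(x, y) = ln (√(det g_ij(x, y)) / σ_F(x))`. -/
def distortion (D : Set (Coord n × Coord n)) (F : Coord n × Coord n → ℝ)
    (p : Coord n × Coord n) : ℝ :=
  Real.log (Real.sqrt (fundTensor F p).det / bhDensity D F p.1)

/-- The curve `c`, on the interval `(-ε, ε)`, is a geodesic of `F` in the coordinate domain, with
all its velocities in `D`: it solves `c''ⁱ + 2 Gⁱ(c, c') = 0`. -/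
def IsGeodesicOn (D : Set (Coord n × Coord n)) (F : Coord n × Coord n → ℝ) (ε : ℝ)
    (c : ℝ → Coord n) : Prop :=
  ∀ t ∈ Set.Ioo (-ε) ε, (c t, deriv c t) ∈ D ∧ DifferentiableAt ℝ c t ∧
    HasDerivAt (deriv c) (WithLp.toLp 2 fun i => -2 * geodCoeff F i (c t, deriv c t)) t

/-- The S-curvature at `p = (x, y)` (with respect to the Busemann–Hausdorff volume form) is the
number `s`: there is a geodesic `c` with `c(0) = x` and `c'(0) = y`, and along every such geodesic
the distortion `τ(c(t), c'(t))` is differentiable at `t = 0` with derivative `s`. -/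
def HasSCurvature (D : Set (Coord n × Coord n)) (F : Coord n × Coord n → ℝ)
    (p : Coord n × Coord n) (s : ℝ) : Prop :=
  (∃ ε > 0, ∃ c : ℝ → Coord n, IsGeodesicOn D F ε c ∧ c 0 = p.1 ∧ deriv c 0 = p.2) ∧
  ∀ ε > 0, ∀ c : ℝ → Coord n, IsGeodesicOn D F ε c → c 0 = p.1 → deriv c 0 = p.2 →
    HasDerivAt (fun t => distortion D F (c t, deriv c t)) s 0

end Local

/-! ### Finsler geometry on a manifold -/

section Global

variable {n : ℕ} {M : Type*} [TopologicalSpace M] [ChartedSpace (Coord n) M]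

/-- The tangent vector at the point with coordinates `p.1` in the chart `e` whose components with
respect to the coordinate frame `∂/∂xⁱ` of `e` are `p.2`. -/
def chartVector (e : OpenPartialHomeomorph M (Coord n)) (p : Coord n × Coord n) :
    TangentSpace (𝓡 n) (e.symm p.1) :=
  mfderiv (𝓡 n) (𝓡 n) e.symm p.1 p.2

/-- The function `F` on tangent vectors in the standard coordinates `(x, y)` given by a chart. -/
def inChart (F : (x : M) → TangentSpace (𝓡 n) x → ℝ) (e : OpenPartialHomeomorph M (Coord n))
    (p : Coord n × Coord n) : ℝ :=
  F (e.symm p.1) (chartVector e p)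

/-- The set of tangent vectors `D` in the standard coordinates `(x, y)` given by a chart. -/
def domainInChart (D : (x : M) → Set (TangentSpace (𝓡 n) x))
    (e : OpenPartialHomeomorph M (Coord n)) : Set (Coord n × Coord n) :=
  {p | p.1 ∈ e.target ∧ chartVector e p ∈ D (e.symm p.1)}

/-- `F`, considered on the tangent vectors in `D`, is an Einstein metric: `Ric = σ F²` for a scalar
function `σ = σ(x)` on `M`, where `Ric` may be computed in any smooth chart. -/
def IsEinstein (D : (x : M) → Set (TangentSpace (𝓡 n) x))
    (F : (x : M) → TangentSpace (𝓡 n) x → ℝ) : Prop :=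
  ∃ σ : M → ℝ, ∀ e ∈ IsManifold.maximalAtlas (𝓡 n) ∞ M, ∀ p ∈ domainInChart D e,
    ricciCurv (inChart F e) p = σ (e.symm p.1) * inChart F e p ^ 2

/-- `F`, considered on the tangent vectors in `D`, has vanishing S-curvature with respect to its
Busemann–Hausdorff volume form (in any smooth chart). -/
def HasVanishingSCurvature (D : (x : M) → Set (TangentSpace (𝓡 n) x))
    (F : (x : M) → TangentSpace (𝓡 n) x → ℝ) : Prop :=
  ∀ e ∈ IsManifold.maximalAtlas (𝓡 n) ∞ M, ∀ p ∈ domainInChart D e,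
    HasSCurvature (domainInChart D e) (inChart F e) p 0

variable [IsManifold (𝓡 n) ∞ M]

variable (n M) in
/-- Smooth Riemannian metrics on `M`. -/
abbrev RiemMetric : Type _ :=
  Bundle.ContMDiffRiemannianMetric (𝓡 n) ∞ (Coord n) (TangentSpace (𝓡 n) : M → Type _)

/-- A field of linear forms on the tangent spaces of `M` is a smooth 1-form. -/
def IsSmoothOneForm (β : (x : M) → TangentSpace (𝓡 n) x →L[ℝ] ℝ) : Prop :=
  ContMDiff (𝓡 n) ((𝓡 n).prod 𝓘(ℝ, Coord n →L[ℝ] ℝ)) ∞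
    (fun x => Bundle.TotalSpace.mk' (Coord n →L[ℝ] ℝ)
      (E := fun x : M => TangentSpace (𝓡 n) x →L[ℝ] Bundle.Trivial M ℝ x) x (β x))

/-- The Kropina metric `F = α²/β`, where `α² = a_ij yⁱ yʲ` is given by the Riemannian metric `a`. -/
def kropina (a : RiemMetric n M) (β : (x : M) → TangentSpace (𝓡 n) x →L[ℝ] ℝ) (x : M)
    (v : TangentSpace (𝓡 n) x) : ℝ :=
  a.inner x v v / β x v

/-- The tangent vectors at which a Kropina metric is considered: those with `β > 0`. -/
def kropinaDomain (β : (x : M) → TangentSpace (𝓡 n) x →L[ℝ] ℝ) (x : M) :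
    Set (TangentSpace (𝓡 n) x) :=
  {v | 0 < β x v}

end Global

end Finsler

end

/-! Multiplying `α²` and `β` by the same positive function does not change `F`. Where `β ≠ 0`, this
allows the normalisation `F = h(y,y)/b(y)` with `b` of `h`-length one; let `w` be the dual unit
field (`isUnitKropina_normalize`). Write `L = h(y,y)`.

The spray of `F` splits as `G = A + P y` with `P = μ/(2L)`. Here `μ` (`sprayRate`) is a cubic form
in `y` built from `db(y,w)` and the symmetrised covariant derivative of `b`, which is the
obstruction to `w` being a Killing field. The point of the splitting is that `A` (`reducedSpray`)
has only powers of `b(y)` as denominators, while `L` is confined to `P`. Along `A` the quantity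
`b(y)` is constant and `L` grows at rate `μ`, so the projective change formula
`sprayRicci_projective` gives `Ric(F) = Ric(A) + (n-1)(3μ²/(4L²) - μ'/(2L))`, where `μ'` is the
derivative of `μ` along `A` (`ricciCurv_eq`).

Suppose `Ric(F) = σF²` and restrict to an affine line `w + t v` in a fibre, with `b(v) = 0`. There
`b = 1`, so `Ric(A)`, `μ` and `μ'` are polynomials in `t`; this is what `YRational` and
`exists_polynomial` record. Multiplying by `4L²` shows that `L = 1 + h(v,v)t²` divides `3(n-1)μ²`.
Hence `μ` vanishes at the imaginary root of `L`. Since `b` has unit length, `μ` involves just two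
real coefficients on the line, and separating real and imaginary parts kills both. Thus `μ = 0`
(`sprayRate_eq_zero`).

The indicatrix is the `h`-ball of radius `1/2` about `w/2`, so `σ_F` is a constant times `√det h`.
Together with the explicit `det g` this makes the distortion a constant plus `(n+1)/2 ·
log(L/b(y)²)` (`exists_distortion_eq`). Along geodesics of `F` both `log L` and `log b(y)` have
derivative `-μ/L = 0`, so `S = 0`. -/

noncomputable section

namespace Finsler

set_option maxSynthPendingDepth 3

/-! ### Functions polynomial in `y` and `1/b(y)` -/

section YRational

variable {n : ℕ}

/-- The pairs `(x, y)` with `x ∈ U` on which the one-form `b` is positive. -/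
def posDomain (U : Set (Coord n)) (b : Coord n → Coord n →L[ℝ] ℝ) : Set (Coord n × Coord n) :=
  {p | p.1 ∈ U ∧ 0 < b p.1 p.2}

theorem isOpen_posDomain {U : Set (Coord n)} {b : Coord n → Coord n →L[ℝ] ℝ} (hU : IsOpen U)
    (hb : ContDiffOn ℝ ∞ b U) : IsOpen (posDomain U b) := by
  have h1 : ContinuousOn (fun p : Coord n × Coord n => b p.1 p.2) (Prod.fst ⁻¹' U) :=
    (hb.continuousOn.comp continuous_fst.continuousOn (fun p hp => hp)).clm_apply
      continuous_snd.continuousOn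
  exact h1.isOpen_inter_preimage (hU.preimage continuous_fst) isOpen_Ioi

/-- Functions of `(x, y)` which are polynomial in `y` and in the inverse of a one-form `b`, with
coefficients depending smoothly on `x`. -/
inductive YRational (U : Set (Coord n)) (b : Coord n → Coord n →L[ℝ] ℝ) :
    (Coord n × Coord n → ℝ) → Prop
  | coeff {c : Coord n → ℝ} (hc : ContDiffOn ℝ ∞ c U) : YRational U b fun p => c p.1
  | coord (i : Fin n) : YRational U b fun p => p.2 i
  | add {f g : Coord n × Coord n → ℝ} (hf : YRational U b f) (hg : YRational U b g) :
      YRational U b fun p => f p + g p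
  | mul {f g : Coord n × Coord n → ℝ} (hf : YRational U b f) (hg : YRational U b g) :
      YRational U b fun p => f p * g p
  | inv : YRational U b fun p => (b p.1 p.2)⁻¹
  | congr {f g : Coord n × Coord n → ℝ} (hf : YRational U b f)
      (h : ∀ p ∈ posDomain U b, f p = g p) : YRational U b g

namespace YRational

variable {U : Set (Coord n)} {b : Coord n → Coord n →L[ℝ] ℝ} {f g : Coord n × Coord n → ℝ}

theorem const (c : ℝ) : YRational U b fun _ => c := coeff (c := fun _ => c) contDiffOn_const

theorem neg (hf : YRational U b f) : YRational U b fun p => -f p :=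
  ((const (-1)).mul hf).congr fun p _ => by ring

theorem sub (hf : YRational U b f) (hg : YRational U b g) : YRational U b fun p => f p - g p :=
  (hf.add hg.neg).congr fun p _ => by ring

theorem sum {ι : Type*} (s : Finset ι) {f : ι → Coord n × Coord n → ℝ}
    (hf : ∀ i ∈ s, YRational U b (f i)) : YRational U b fun p => ∑ i ∈ s, f i p := by
  classical
  induction s using Finset.induction_on with
  | empty => simpa using const 0
  | insert i s hi ih =>
    simp only [Finset.sum_insert hi]
    exact (hf i (by simp)).add (ih fun j hj => hf j (by simp [hj]))

theorem eq_sum_single (y : Coord n) : y = ∑ i, y i • EuclideanSpace.single i (1 : ℝ) := by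
  ext j
  simp [Finset.sum_apply, Pi.single_apply]

/-- A one-form is linear in the fibre coordinates. -/
theorem oneForm {c : Coord n → Coord n →L[ℝ] ℝ} (hc : ContDiffOn ℝ ∞ c U) :
    YRational U b fun p => c p.1 p.2 := by
  have h : YRational U b fun p => ∑ i, p.2 i * c p.1 (EuclideanSpace.single i 1) :=
    sum _ fun i _ => (coord i).mul
      (coeff (c := fun x => c x (EuclideanSpace.single i 1)) (hc.clm_apply contDiffOn_const))
  refine h.congr fun p _ => ?_
  conv_rhs => rw [eq_sum_single p.2]
  simp

/-- A bilinear form is quadratic in the fibre coordinates. -/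
theorem bilinForm {c : Coord n → Coord n →L[ℝ] Coord n →L[ℝ] ℝ} (hc : ContDiffOn ℝ ∞ c U) :
    YRational U b fun p => c p.1 p.2 p.2 := by
  have h : YRational U b fun p => ∑ i, p.2 i * c p.1 (EuclideanSpace.single i 1) p.2 :=
    sum _ fun i _ => (coord i).mul
      (oneForm (c := fun x => c x (EuclideanSpace.single i 1)) (hc.clm_apply contDiffOn_const))
  refine h.congr fun p _ => ?_
  have h1 : ∀ y z : Coord n, ∑ i, y i * c p.1 (EuclideanSpace.single i 1) z = c p.1 y z := by
    intro y z
    conv_rhs => rw [eq_sum_single y]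
    simp
  exact h1 _ _

theorem contDiffOn (hb : ContDiffOn ℝ ∞ b U) (hf : YRational U b f) :
    ContDiffOn ℝ ∞ f (posDomain U b) := by
  induction hf with
  | coeff hc => exact hc.comp contDiffOn_fst fun p hp => hp.1
  | coord i => exact ((EuclideanSpace.proj (𝕜 := ℝ) i).contDiff.comp contDiff_snd).contDiffOn
  | add _ _ hf hg => exact hf.add hg
  | mul _ _ hf hg => exact hf.mul hg
  | inv =>
    exact ((hb.comp contDiffOn_fst fun p hp => hp.1).clm_apply contDiffOn_snd).inv
      fun p hp => hp.2.ne'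
  | congr _ h hf => exact hf.congr fun p hp => (h p hp).symm

theorem differentiableAt (hU : IsOpen U) (hb : ContDiffOn ℝ ∞ b U) (hf : YRational U b f)
    {p : Coord n × Coord n} (hp : p ∈ posDomain U b) : DifferentiableAt ℝ f p :=
  ((hf.contDiffOn hb).contDiffAt ((isOpen_posDomain hU hb).mem_nhds hp)).differentiableAt (by simp)

theorem fderiv_oneForm {c : Coord n → Coord n →L[ℝ] ℝ} {p : Coord n × Coord n}
    (hc : DifferentiableAt ℝ c p.1) (d : Coord n × Coord n) :
    fderiv ℝ (fun p : Coord n × Coord n => c p.1 p.2) p d = fderiv ℝ c p.1 d.1 p.2 + c p.1 d.2 := by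
  have h1 : HasFDerivAt (fun p : Coord n × Coord n => c p.1) _ p :=
    hc.hasFDerivAt.comp p hasFDerivAt_fst
  rw [(h1.clm_apply hasFDerivAt_snd).fderiv]
  simp [add_comm]

/-- Differentiating `1/b(y)` only raises the power of `1/b(y)`, so no new denominator appears. This
is why curvature expressions formed from such functions stay in the class. -/
theorem fderiv_apply (hU : IsOpen U) (hb : ContDiffOn ℝ ∞ b U) (d : Coord n × Coord n)
    (hf : YRational U b f) : YRational U b fun p => fderiv ℝ f p d := by
  have hD : IsOpen (posDomain U b) := isOpen_posDomain hU hb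
  induction hf with
  | @coeff c hc =>
    have h : ContDiffOn ℝ ∞ (fun x => fderiv ℝ c x d.1) U :=
      (hc.fderiv_of_isOpen hU (by simp)).clm_apply contDiffOn_const
    refine (coeff h).congr fun p hp => ?_
    have h1 : DifferentiableAt ℝ c p.1 :=
      (hc.contDiffAt (hU.mem_nhds hp.1)).differentiableAt (by simp)
    have h2 : HasFDerivAt (fun p : Coord n × Coord n => c p.1) _ p :=
      h1.hasFDerivAt.comp p hasFDerivAt_fst
    rw [h2.fderiv]
    rfl
  | coord i =>
    refine (const (d.2 i)).congr fun p _ => ?_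
    have h2 : HasFDerivAt (fun p : Coord n × Coord n => p.2 i) _ p :=
      (EuclideanSpace.proj (𝕜 := ℝ) i).hasFDerivAt.comp p hasFDerivAt_snd
    rw [h2.fderiv]
    rfl
  | add hf hg ihf ihg =>
    refine (ihf.add ihg).congr fun p hp => ?_
    rw [fderiv_fun_add (hf.differentiableAt hU hb hp) (hg.differentiableAt hU hb hp)]
    rfl
  | mul hf hg ihf ihg =>
    refine ((hf.mul ihg).add (hg.mul ihf)).congr fun p hp => ?_
    rw [fderiv_fun_mul (hf.differentiableAt hU hb hp) (hg.differentiableAt hU hb hp)]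
    rfl
  | inv =>
    have h1 : ContDiffOn ℝ ∞ (fun x => fderiv ℝ b x d.1) U :=
      (hb.fderiv_of_isOpen hU (by simp)).clm_apply contDiffOn_const
    have h2 : ContDiffOn ℝ ∞ (fun x => b x d.2) U := hb.clm_apply contDiffOn_const
    refine (((oneForm h1).add (coeff h2)).mul (inv.mul inv)).neg.congr fun p hp => ?_
    have h3 : DifferentiableAt ℝ b p.1 :=
      (hb.contDiffAt (hU.mem_nhds hp.1)).differentiableAt (by simp)
    have h4 := (oneForm (b := b) hb).differentiableAt hU hb hp
    have h5 := (hasDerivAt_inv hp.2.ne').comp_hasFDerivAt p h4.hasFDerivAt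
    have h6 : fderiv ℝ (fun p : Coord n × Coord n => (b p.1 p.2)⁻¹) p = _ := h5.fderiv
    rw [h6, smul_apply, fderiv_oneForm h3, smul_eq_mul]
    field_simp
  | congr _ h ih =>
    refine ih.congr fun p hp => ?_
    have : _ =ᶠ[nhds p] _ := Filter.eventuallyEq_of_mem (hD.mem_nhds hp) h
    rw [this.fderiv_eq]

theorem dx (hU : IsOpen U) (hb : ContDiffOn ℝ ∞ b U) (hf : YRational U b f) (i : Fin n) :
    YRational U b (dx i f) := hf.fderiv_apply hU hb _

theorem dy (hU : IsOpen U) (hb : ContDiffOn ℝ ∞ b U) (hf : YRational U b f) (i : Fin n) :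
    YRational U b (dy i f) := hf.fderiv_apply hU hb _

/-- On a line in a fibre on which `b` equals `1` such a function is polynomial. -/
theorem exists_polynomial (hf : YRational U b f) {x : Coord n} (hx : x ∈ U) {w v : Coord n}
    (hw : b x w = 1) (hv : b x v = 0) :
    ∃ q : Polynomial ℝ, ∀ t : ℝ, f (x, w + t • v) = q.eval t := by
  induction hf with
  | @coeff c hc => exact ⟨.C (c x), fun t => by simp⟩
  | coord i => exact ⟨.C (w i) + .C (v i) * .X, fun t => by simp; ring⟩
  | add _ _ hf hg =>
    obtain ⟨q, hq⟩ := hf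
    obtain ⟨r, hr⟩ := hg
    exact ⟨q + r, fun t => by simp [hq, hr]⟩
  | mul _ _ hf hg =>
    obtain ⟨q, hq⟩ := hf
    obtain ⟨r, hr⟩ := hg
    exact ⟨q * r, fun t => by simp [hq, hr]⟩
  -- The form is identically `1` along the line, so the only admitted denominator disappears.
  | inv => exact ⟨1, fun t => by simp [hw, hv]⟩
  | congr _ h hf =>
    obtain ⟨q, hq⟩ := hf
    -- The line stays in `b > 0` for every real `t`, so agreement on the domain is enough.
    exact ⟨q, fun t => by rw [← hq, h]; exact ⟨hx, by simp [hw, hv]⟩⟩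

end YRational

end YRational

/-! ### Dual vectors and their smooth dependence on the base point -/

section Sharp

variable {n : ℕ}

/-- The vector dual to a one-form with respect to a nondegenerate bilinear form. -/
def sharp (B : Coord n →L[ℝ] Coord n →L[ℝ] ℝ) (ξ : Coord n →L[ℝ] ℝ) : Coord n :=
  ContinuousLinearMap.inverse B ξ

theorem exists_equiv_of_pos {B : Coord n →L[ℝ] Coord n →L[ℝ] ℝ} (hB : ∀ v, v ≠ 0 → 0 < B v v) :
    ∃ e : Coord n ≃L[ℝ] (Coord n →L[ℝ] ℝ), (e : Coord n →L[ℝ] Coord n →L[ℝ] ℝ) = B := by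
  have hinj : Function.Injective (B : Coord n →ₗ[ℝ] Coord n →L[ℝ] ℝ) := by
    rw [injective_iff_map_eq_zero]
    intro v hv
    by_contra hne
    have h1 := hB v hne
    have h2 : B v = 0 := hv
    simp [h2] at h1
  have hrank : Module.finrank ℝ (Coord n) = Module.finrank ℝ (Coord n →L[ℝ] ℝ) := by
    rw [← (LinearMap.toContinuousLinearMap (𝕜 := ℝ) (E := Coord n) (F' := ℝ)).finrank_eq]
    exact (Subspace.dual_finrank_eq (K := ℝ) (V := Coord n)).symm
  exact ⟨(LinearEquiv.ofInjectiveOfFinrankEq _ hinj hrank).toContinuousLinearEquiv, by ext; rfl⟩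

theorem apply_sharp {B : Coord n →L[ℝ] Coord n →L[ℝ] ℝ} (hB : ∀ v, v ≠ 0 → 0 < B v v)
    (ξ : Coord n →L[ℝ] ℝ) : B (sharp B ξ) = ξ := by
  obtain ⟨e, rfl⟩ := exists_equiv_of_pos hB
  simp [sharp]

/-- Inversion of operators is smooth near an invertible one, and positivity makes each `h x`
invertible. -/
theorem contDiffOn_sharp {U : Set (Coord n)} {h : Coord n → Coord n →L[ℝ] Coord n →L[ℝ] ℝ}
    (hh : ContDiffOn ℝ ∞ h U) (hpos : ∀ x ∈ U, ∀ v, v ≠ 0 → 0 < h x v v)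
    {ξ : Coord n → Coord n →L[ℝ] ℝ} (hξ : ContDiffOn ℝ ∞ ξ U) :
    ContDiffOn ℝ ∞ (fun x => sharp (h x) (ξ x)) U := by
  intro x hx
  obtain ⟨e, he⟩ := exists_equiv_of_pos (hpos x hx)
  have h1 : ContDiffAt ℝ ∞ ContinuousLinearMap.inverse (h x) := by
    rw [← he]
    exact contDiffAt_map_inverse e
  exact (h1.comp_contDiffWithinAt x (hh x hx)).clm_apply (hξ x hx)

end Sharp

/-- A Kropina metric `h(y,y)/b(y)` in a coordinate domain, normalised so that the one-form `b` has
length one with respect to the Riemannian metric `h`; `w` is the vector field dual to `b`. -/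
structure IsUnitKropina {n : ℕ} (U : Set (Coord n)) (h : Coord n → Coord n →L[ℝ] Coord n →L[ℝ] ℝ)
    (b : Coord n → Coord n →L[ℝ] ℝ) (w : Coord n → Coord n) : Prop where
  isOpen : IsOpen U
  contDiffOn_metric : ContDiffOn ℝ ∞ h U
  contDiffOn_form : ContDiffOn ℝ ∞ b U
  contDiffOn_dual : ContDiffOn ℝ ∞ w U
  symm : ∀ x ∈ U, ∀ v z, h x v z = h x z v
  pos : ∀ x ∈ U, ∀ v, v ≠ 0 → 0 < h x v v
  dual : ∀ x ∈ U, ∀ v, h x (w x) v = b x v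
  unit : ∀ x ∈ U, b x (w x) = 1

/-! ### The spray of a unit Kropina metric -/

section Spray

variable {n : ℕ} (h : Coord n → Coord n →L[ℝ] Coord n →L[ℝ] ℝ) (b : Coord n → Coord n →L[ℝ] ℝ)
  (w : Coord n → Coord n)

/-- The quadratic form `h(y, y)`. -/
def metricSq (p : Coord n × Coord n) : ℝ := h p.1 p.2 p.2

/-- The contraction `db(y, w)` of the exterior derivative of `b`. -/
def curlForm (p : Coord n × Coord n) : ℝ :=
  fderiv ℝ b p.1 p.2 (w p.1) - fderiv ℝ b p.1 (w p.1) p.2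

/-- The symmetrised covariant derivative of `b`, as a quadratic form in `y`. -/
def killingDefect (p : Coord n × Coord n) : ℝ :=
  fderiv ℝ b p.1 p.2 p.2 - fderiv ℝ h p.1 p.2 p.2 (w p.1)
    + (1 / 2) * fderiv ℝ h p.1 (w p.1) p.2 p.2

/-- The derivative of `h(y, y)` along the spray `reducedSpray`. -/
def sprayRate (p : Coord n × Coord n) : ℝ :=
  -(metricSq h p * curlForm b w p) - 2 * b p.1 p.2 * killingDefect h b w p

/-- The one-form dual to `reducedSpray`. -/
def sprayForm (p : Coord n × Coord n) : Coord n →L[ℝ] ℝ :=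
  (1 / 2 : ℝ) • fderiv ℝ h p.1 p.2 p.2
    - (1 / 4 : ℝ) • ((fderiv ℝ h p.1).flip p.2).flip p.2
    - ((1 / 4) * (b p.1 p.2)⁻¹) • (sprayRate h b w p • b p.1
      + metricSq h p • (fderiv ℝ b p.1 p.2 - (fderiv ℝ b p.1).flip p.2))

/-- The spray projectively equivalent to that of the Kropina metric whose geodesics have constant
`b(y)`. -/
def reducedSpray (p : Coord n × Coord n) : Coord n := sharp (h p.1) (sprayForm h b w p)

/-- The projective factor relating the spray of the Kropina metric to `reducedSpray`. -/
def sprayFactor (p : Coord n × Coord n) : ℝ := sprayRate h b w p / (2 * metricSq h p)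

/-- The spray of the Kropina metric. -/
def kropinaSpray (p : Coord n × Coord n) : Coord n :=
  reducedSpray h b w p + sprayFactor h b w p • p.2

theorem sprayForm_apply (p : Coord n × Coord n) (z : Coord n) :
    sprayForm h b w p z = (1 / 2) * fderiv ℝ h p.1 p.2 p.2 z - (1 / 4) * fderiv ℝ h p.1 z p.2 p.2
      - (1 / 4) * (b p.1 p.2)⁻¹ * (sprayRate h b w p * b p.1 z
        + metricSq h p * (fderiv ℝ b p.1 p.2 z - fderiv ℝ b p.1 z p.2)) := by
  simp [sprayForm]
  ring

variable {h b w} {U : Set (Coord n)}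

namespace IsUnitKropina

theorem isOpen_posDomain (H : IsUnitKropina U h b w) : IsOpen (posDomain U b) :=
  Finsler.isOpen_posDomain H.isOpen H.contDiffOn_form

theorem ne_zero {p : Coord n × Coord n} (hp : p ∈ posDomain U b) : p.2 ≠ 0 := by
  intro h0
  have := hp.2
  simp [h0] at this

theorem metricSq_pos (H : IsUnitKropina U h b w) {p : Coord n × Coord n}
    (hp : p ∈ posDomain U b) : 0 < metricSq h p :=
  H.pos _ hp.1 _ (ne_zero hp)

theorem contDiffOn_fderiv_metric (H : IsUnitKropina U h b w) : ContDiffOn ℝ ∞ (fderiv ℝ h) U :=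
  H.contDiffOn_metric.fderiv_of_isOpen H.isOpen (by simp)

theorem contDiffOn_fderiv_form (H : IsUnitKropina U h b w) : ContDiffOn ℝ ∞ (fderiv ℝ b) U :=
  H.contDiffOn_form.fderiv_of_isOpen H.isOpen (by simp)

theorem yRational_metricSq (H : IsUnitKropina U h b w) : YRational U b (metricSq h) :=
  .bilinForm H.contDiffOn_metric

theorem yRational_form (H : IsUnitKropina U h b w) : YRational U b fun p => b p.1 p.2 :=
  .oneForm H.contDiffOn_form

theorem contDiffOn_flip {c : Coord n → Coord n →L[ℝ] Coord n →L[ℝ] ℝ} (hc : ContDiffOn ℝ ∞ c U) :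
    ContDiffOn ℝ ∞ (fun x => (c x).flip) U :=
  (ContinuousLinearMap.flipₗᵢ ℝ (Coord n) (Coord n) ℝ).contDiff.comp_contDiffOn hc

theorem contDiffOn_flip_fderiv_form (H : IsUnitKropina U h b w) (v : Coord n) :
    ContDiffOn ℝ ∞ (fun x => (fderiv ℝ b x).flip v) U :=
  (contDiffOn_flip H.contDiffOn_fderiv_form).clm_apply contDiffOn_const

theorem yRational_curlForm (H : IsUnitKropina U h b w) : YRational U b (curlForm b w) := by
  have h1 : ContDiffOn ℝ ∞ (fun x => (fderiv ℝ b x).flip (w x)) U :=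
    (contDiffOn_flip H.contDiffOn_fderiv_form).clm_apply H.contDiffOn_dual
  exact (YRational.oneForm h1).sub
    (.oneForm (H.contDiffOn_fderiv_form.clm_apply H.contDiffOn_dual))

/-- The contraction of the derivative of the metric with `y`, `y` and a smooth vector field. -/
theorem yRational_fderiv_metric (H : IsUnitKropina U h b w) {v : Coord n → Coord n}
    (hv : ContDiffOn ℝ ∞ v U) :
    YRational U b fun p => fderiv ℝ h p.1 p.2 p.2 (v p.1) := by
  have h1 : YRational U b fun p => ∑ i, p.2 i *
      fderiv ℝ h p.1 (EuclideanSpace.single i 1) p.2 (v p.1) := by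
    refine .sum _ fun i _ => (YRational.coord i).mul ?_
    exact .oneForm (c := fun x => (fderiv ℝ h x (EuclideanSpace.single i 1)).flip (v x))
      ((contDiffOn_flip (H.contDiffOn_fderiv_metric.clm_apply contDiffOn_const)).clm_apply hv)
  refine h1.congr fun p _ => ?_
  have h2 : ∀ y z : Coord n, ∑ i, y i * fderiv ℝ h p.1 (EuclideanSpace.single i 1) z (v p.1)
      = fderiv ℝ h p.1 y z (v p.1) := by
    intro y z
    conv_rhs => rw [YRational.eq_sum_single y]
    simp
  exact h2 _ _

theorem yRational_killingDefect (H : IsUnitKropina U h b w) : YRational U b (killingDefect h b w) :=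
  ((YRational.bilinForm H.contDiffOn_fderiv_form).sub
    (H.yRational_fderiv_metric H.contDiffOn_dual)).add
    ((YRational.const _).mul
      (.bilinForm (H.contDiffOn_fderiv_metric.clm_apply H.contDiffOn_dual)))

theorem yRational_sprayRate (H : IsUnitKropina U h b w) : YRational U b (sprayRate h b w) :=
  (H.yRational_metricSq.mul H.yRational_curlForm).neg.sub
    (((YRational.const 2).mul H.yRational_form).mul H.yRational_killingDefect)

theorem yRational_sprayForm (H : IsUnitKropina U h b w) (v : Coord n) :
    YRational U b fun p => sprayForm h b w p v := by
  have h1 : YRational U b fun p => fderiv ℝ b p.1 p.2 v :=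
    .oneForm (c := fun x => (fderiv ℝ b x).flip v) (H.contDiffOn_flip_fderiv_form v)
  have h2 : YRational U b fun p => fderiv ℝ b p.1 v p.2 :=
    .oneForm (H.contDiffOn_fderiv_form.clm_apply contDiffOn_const)
  have h3 : YRational U b fun p => fderiv ℝ h p.1 v p.2 p.2 :=
    .bilinForm (H.contDiffOn_fderiv_metric.clm_apply contDiffOn_const)
  have h4 : YRational U b fun p => b p.1 v :=
    .coeff (c := fun x => b x v) (H.contDiffOn_form.clm_apply contDiffOn_const)
  refine ((((YRational.const (1 / 2)).mul
    (H.yRational_fderiv_metric (v := fun _ => v) contDiffOn_const)).sub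
    ((YRational.const (1 / 4)).mul h3)).sub
    (((YRational.const (1 / 4)).mul .inv).mul ((H.yRational_sprayRate.mul h4).add
      (H.yRational_metricSq.mul (h1.sub h2))))).congr fun p _ => ?_
  rw [sprayForm_apply]

/-- Raising the index involves `x` only, so the dual vector inherits the denominators of the
covector: powers of `b(y)`, never `h(y,y)`. -/
theorem yRational_reducedSpray (H : IsUnitKropina U h b w) (i : Fin n) :
    YRational U b fun p => reducedSpray h b w p i := by
  have h1 : ∀ j, ContDiffOn ℝ ∞ (fun x => sharp (h x) (EuclideanSpace.proj (𝕜 := ℝ) j) i) U :=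
    fun j => (EuclideanSpace.proj (𝕜 := ℝ) i).contDiff.comp_contDiffOn
      (contDiffOn_sharp H.contDiffOn_metric H.pos contDiffOn_const)
  refine (YRational.sum Finset.univ fun j _ =>
    (H.yRational_sprayForm (EuclideanSpace.single j 1)).mul (.coeff (h1 j))).congr fun p _ => ?_
  have h2 : sprayForm h b w p = ∑ j, sprayForm h b w p (EuclideanSpace.single j 1) •
      EuclideanSpace.proj (𝕜 := ℝ) j := by
    ext y
    conv_lhs => rw [YRational.eq_sum_single y]
    simp [mul_comm]
  conv_rhs => rw [reducedSpray, sharp, h2]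
  simp [sharp]

theorem metric_reducedSpray (H : IsUnitKropina U h b w) {p : Coord n × Coord n}
    (hp : p ∈ posDomain U b) :
    h p.1 (reducedSpray h b w p) = sprayForm h b w p :=
  apply_sharp (H.pos _ hp.1) _

/-- Pairing with `b` is evaluating `sprayForm` at `w`; the definition of `sprayRate` is chosen so
that the result expresses conservation of `b(y)` along this spray. -/
theorem form_reducedSpray (H : IsUnitKropina U h b w) {p : Coord n × Coord n}
    (hp : p ∈ posDomain U b) :
    2 * b p.1 (reducedSpray h b w p) = fderiv ℝ b p.1 p.2 p.2 := by
  have hb := hp.2.ne'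
  rw [← H.dual _ hp.1, H.symm _ hp.1, H.metric_reducedSpray hp, sprayForm_apply, H.unit _ hp.1,
    sprayRate, killingDefect, curlForm]
  field_simp
  ring

/-- The `db` term of `sprayForm` is antisymmetric and drops out on `y`. -/
theorem metric_reducedSpray_self (H : IsUnitKropina U h b w) {p : Coord n × Coord n}
    (hp : p ∈ posDomain U b) :
    4 * h p.1 (reducedSpray h b w p) p.2 = fderiv ℝ h p.1 p.2 p.2 p.2 - sprayRate h b w p := by
  have hb := hp.2.ne'
  rw [H.metric_reducedSpray hp, sprayForm_apply]
  field_simp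
  ring

end IsUnitKropina

end Spray

/-! ### Ricci curvature of sprays and projective change -/

section Projective

variable {n : ℕ}

/-- The Ricci curvature of the spray with coefficients `G`. -/
def sprayRicci (G : Fin n → Coord n × Coord n → ℝ) (p : Coord n × Coord n) : ℝ :=
  ∑ i, (2 * dx i (G i) p
    - ∑ m, p.2 m * dx m (dy i (G i)) p
    + 2 * ∑ m, G m p * dy m (dy i (G i)) p
    - ∑ m, dy m (G i) p * dy i (G m) p)

theorem ricciCurv_eq_sprayRicci (F : Coord n × Coord n → ℝ) (p : Coord n × Coord n) :
    ricciCurv F p = sprayRicci (geodCoeff F) p := rfl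

section Calculus

variable {D : Set (Coord n × Coord n)} {f g : Coord n × Coord n → ℝ} {p : Coord n × Coord n}

theorem dx_congr (hD : IsOpen D) (hp : p ∈ D) (h : ∀ q ∈ D, f q = g q) (i : Fin n) :
    dx i f p = dx i g p := by
  have : f =ᶠ[nhds p] g := Filter.eventuallyEq_of_mem (hD.mem_nhds hp) h
  rw [dx, dx, this.fderiv_eq]

theorem dy_congr (hD : IsOpen D) (hp : p ∈ D) (h : ∀ q ∈ D, f q = g q) (i : Fin n) :
    dy i f p = dy i g p := by
  have : f =ᶠ[nhds p] g := Filter.eventuallyEq_of_mem (hD.mem_nhds hp) h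
  rw [dy, dy, this.fderiv_eq]

theorem contDiffOn_dy (hD : IsOpen D) (hf : ContDiffOn ℝ ∞ f D) (i : Fin n) :
    ContDiffOn ℝ ∞ (dy i f) D :=
  (hf.fderiv_of_isOpen hD (by simp)).clm_apply contDiffOn_const

theorem ContDiffOn.differentiableAt_of_isOpen (hD : IsOpen D) (hf : ContDiffOn ℝ ∞ f D)
    (hp : p ∈ D) : DifferentiableAt ℝ f p :=
  (hf.contDiffAt (hD.mem_nhds hp)).differentiableAt (by simp)

theorem hasFDerivAt_coord (i : Fin n) (p : Coord n × Coord n) :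
    HasFDerivAt (fun p : Coord n × Coord n => p.2 i)
      ((EuclideanSpace.proj (𝕜 := ℝ) i).comp
        (ContinuousLinearMap.snd ℝ (Coord n) (Coord n))) p :=
  (EuclideanSpace.proj (𝕜 := ℝ) i).hasFDerivAt.comp p hasFDerivAt_snd

theorem contDiff_coord (i : Fin n) :
    ContDiff ℝ ∞ (fun p : Coord n × Coord n => p.2 i) :=
  (EuclideanSpace.proj (𝕜 := ℝ) i).contDiff.comp contDiff_snd

theorem dx_add_mul_coord (hf : DifferentiableAt ℝ f p) (hg : DifferentiableAt ℝ g p)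
    (i j : Fin n) : dx j (fun q => f q + g q * q.2 i) p = dx j f p + p.2 i * dx j g p := by
  have := hf.hasFDerivAt.add (hg.hasFDerivAt.mul (hasFDerivAt_coord i p))
  simp only [dx]
  erw [this.fderiv]
  simp

theorem dy_add_mul_coord (hf : DifferentiableAt ℝ f p) (hg : DifferentiableAt ℝ g p)
    (i j : Fin n) : dy j (fun q => f q + g q * q.2 i) p =
      dy j f p + (if i = j then g p else 0) + p.2 i * dy j g p := by
  have := hf.hasFDerivAt.add (hg.hasFDerivAt.mul (hasFDerivAt_coord i p))
  simp only [dy]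
  erw [this.fderiv]
  simp [add_assoc]

theorem dx_sum {ι : Type*} (s : Finset ι) {f : ι → Coord n × Coord n → ℝ}
    (hf : ∀ i ∈ s, DifferentiableAt ℝ (f i) p) (j : Fin n) :
    dx j (fun q => ∑ i ∈ s, f i q) p = ∑ i ∈ s, dx j (f i) p := by
  simp only [dx, fderiv_fun_sum hf]
  simp

theorem dy_sum {ι : Type*} (s : Finset ι) {f : ι → Coord n × Coord n → ℝ}
    (hf : ∀ i ∈ s, DifferentiableAt ℝ (f i) p) (j : Fin n) :
    dy j (fun q => ∑ i ∈ s, f i q) p = ∑ i ∈ s, dy j (f i) p := by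
  simp only [dy, fderiv_fun_sum hf]
  simp

theorem dx_add_const_mul (hf : DifferentiableAt ℝ f p) (hg : DifferentiableAt ℝ g p)
    (c : ℝ) (j : Fin n) : dx j (fun q => f q + c * g q) p = dx j f p + c * dx j g p := by
  simp only [dx]
  rw [fderiv_fun_add hf (hg.const_mul c), fderiv_const_mul hg]
  simp

theorem dy_add_const_mul (hf : DifferentiableAt ℝ f p) (hg : DifferentiableAt ℝ g p)
    (c : ℝ) (j : Fin n) : dy j (fun q => f q + c * g q) p = dy j f p + c * dy j g p := by
  simp only [dy]
  rw [fderiv_fun_add hf (hg.const_mul c), fderiv_const_mul hg]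
  simp

theorem sum_coord_mul_dy (f : Coord n × Coord n → ℝ) (p : Coord n × Coord n) (v : Coord n) :
    ∑ k, v k * dy k f p = fderiv ℝ f p (0, v) := by
  have h : ((0 : Coord n), v) = ∑ k, v k • ((0 : Coord n), EuclideanSpace.single k (1 : ℝ)) := by
    conv_lhs => rw [YRational.eq_sum_single v]
    simp [Prod.ext_iff, Prod.fst_sum, Prod.snd_sum]
  rw [h]
  simp only [map_sum, map_smul, smul_eq_mul, dy]

theorem sum_coord_mul_dx (f : Coord n × Coord n → ℝ) (p : Coord n × Coord n) (v : Coord n) :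
    ∑ k, v k * dx k f p = fderiv ℝ f p (v, 0) := by
  have h : (v, (0 : Coord n)) = ∑ k, v k • (EuclideanSpace.single k (1 : ℝ), (0 : Coord n)) := by
    conv_lhs => rw [YRational.eq_sum_single v]
    simp [Prod.ext_iff, Prod.fst_sum, Prod.snd_sum]
  rw [h]
  simp only [map_sum, map_smul, smul_eq_mul, dx]

end Calculus

section Homogeneous

/-- Positive homogeneity of degree `k` in the fibre coordinates. -/
def IsYHomogeneous (D : Set (Coord n × Coord n)) (k : ℕ) (f : Coord n × Coord n → ℝ) : Prop :=
  ∀ p ∈ D, ∀ t : ℝ, 0 < t → f (p.1, t • p.2) = t ^ k * f p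

variable {D : Set (Coord n × Coord n)} {f : Coord n × Coord n → ℝ} {p : Coord n × Coord n} {k : ℕ}

theorem IsYHomogeneous.euler (hf : IsYHomogeneous D k f) (hp : p ∈ D)
    (hd : DifferentiableAt ℝ f p) : fderiv ℝ f p (0, p.2) = k * f p := by
  have h1 : HasDerivAt (fun t : ℝ => (p.1, t • p.2)) ((0 : Coord n), p.2) 1 := by
    have := (hasDerivAt_id (1 : ℝ)).smul_const p.2
    rw [one_smul] at this
    exact (hasDerivAt_const (1 : ℝ) p.1).prodMk this
  have h2 : HasDerivAt (fun t : ℝ => f (p.1, t • p.2)) (fderiv ℝ f p (0, p.2)) 1 := by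
    have hd' : HasFDerivAt f (fderiv ℝ f p) (p.1, (1 : ℝ) • p.2) := by
      rw [one_smul]
      exact hd.hasFDerivAt
    exact hd'.comp_hasDerivAt (1 : ℝ) h1
  have h3 : HasDerivAt (fun t : ℝ => t ^ k * f p) (k * f p) 1 := by
    simpa using (hasDerivAt_pow k (1 : ℝ)).mul_const (f p)
  have h4 : (fun t : ℝ => f (p.1, t • p.2)) =ᶠ[nhds 1] fun t => t ^ k * f p :=
    Filter.eventuallyEq_of_mem (isOpen_Ioi.mem_nhds one_pos) fun t ht => hf p hp t ht
  exact h2.unique (h3.congr_of_eventuallyEq h4)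

/-- Differentiating `f(x, ty) = t^(k+1) f(x, y)` in `y` produces a factor `t` on the left, which is
cancelled. -/
theorem IsYHomogeneous.dy (hD : IsOpen D) (hcone : ∀ q ∈ D, ∀ t : ℝ, 0 < t → (q.1, t • q.2) ∈ D)
    (hf : IsYHomogeneous D (k + 1) f) (hd : ∀ q ∈ D, DifferentiableAt ℝ f q) (i : Fin n) :
    IsYHomogeneous D k (dy i f) := by
  intro q hq t ht
  have h1 : HasFDerivAt (fun z : Coord n × Coord n => (z.1, t • z.2))
      ((ContinuousLinearMap.fst ℝ (Coord n) (Coord n)).prod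
        (t • ContinuousLinearMap.snd ℝ (Coord n) (Coord n))) q :=
    hasFDerivAt_fst.prodMk (hasFDerivAt_snd.const_smul t)
  have h2 := (hd _ (hcone q hq t ht)).hasFDerivAt.comp q h1
  have h3 : (f ∘ fun z : Coord n × Coord n => (z.1, t • z.2)) =ᶠ[nhds q]
      fun z => t ^ (k + 1) * f z :=
    Filter.eventuallyEq_of_mem (hD.mem_nhds hq) fun z hz => hf z hz t ht
  have h4 := h2.unique (((hd q hq).hasFDerivAt.const_mul (t ^ (k + 1))).congr_of_eventuallyEq h3)
  have h5 : fderiv ℝ f (q.1, t • q.2) (0, t • EuclideanSpace.single i (1 : ℝ)) =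
      t ^ (k + 1) * fderiv ℝ f q (0, EuclideanSpace.single i (1 : ℝ)) :=
    congrArg (fun φ => φ ((0 : Coord n), EuclideanSpace.single i (1 : ℝ))) h4
  have h6 : ((0 : Coord n), t • EuclideanSpace.single i (1 : ℝ)) =
      t • ((0 : Coord n), EuclideanSpace.single i (1 : ℝ)) := by simp
  rw [h6, map_smul, smul_eq_mul] at h5
  refine mul_left_cancel₀ ht.ne' ?_
  rw [Finsler.dy, Finsler.dy, h5]
  ring

end Homogeneous

/-- The fibre divergence of a spray. -/
def sprayDiv (G : Fin n → Coord n × Coord n → ℝ) (p : Coord n × Coord n) : ℝ := ∑ i, dy i (G i) p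

variable {D : Set (Coord n × Coord n)} {G A : Fin n → Coord n × Coord n → ℝ}
  {P : Coord n × Coord n → ℝ} {p : Coord n × Coord n}

/-- Grouping the second derivatives into those of the fibre divergence leaves first derivatives only
of `G` and of one scalar function to follow under a projective change. -/
theorem sprayRicci_eq (hD : IsOpen D) (hG : ∀ i, ContDiffOn ℝ ∞ (G i) D) (hp : p ∈ D) :
    sprayRicci G p = 2 * ∑ i, dx i (G i) p - ∑ m, p.2 m * dx m (sprayDiv G) p
      + 2 * ∑ m, G m p * dy m (sprayDiv G) p - ∑ i, ∑ m, dy m (G i) p * dy i (G m) p := by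
  have h1 : ∀ i ∈ Finset.univ, DifferentiableAt ℝ (dy i (G i)) p := fun i _ =>
    ContDiffOn.differentiableAt_of_isOpen hD (contDiffOn_dy hD (hG i) i) hp
  have h2 : ∀ m, dx m (sprayDiv G) p = ∑ i, dx m (dy i (G i)) p := fun m => dx_sum _ h1 m
  have h3 : ∀ m, dy m (sprayDiv G) p = ∑ i, dy m (dy i (G i)) p := fun m => dy_sum _ h1 m
  simp only [sprayRicci, h2, h3, Finset.sum_sub_distrib, Finset.sum_add_distrib,
    ← Finset.mul_sum]
  rw [Finset.sum_comm (f := fun i m => p.2 m * dx m (dy i (G i)) p),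
    Finset.sum_comm (f := fun i m => G m p * dy m (dy i (G i)) p)]
  simp only [← Finset.mul_sum]

/-- The trace of `(a + c·1 + y ⊗ q)²`, the form taken by the fibre Jacobian of `A + P y` with `c =
P` and `q = ∂P/∂y`. -/
theorem sum_mul_transpose (a : Fin n → Fin n → ℝ) (y q : Fin n → ℝ) (c : ℝ) :
    ∑ i, ∑ m, (a i m + (if i = m then c else 0) + y i * q m)
        * (a m i + (if m = i then c else 0) + y m * q i)
      = (∑ i, ∑ m, a i m * a m i) + 2 * c * (∑ i, a i i) + n * c ^ 2
        + 2 * (∑ i, q i * ∑ m, y m * a i m) + 2 * c * (∑ i, y i * q i)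
        + (∑ i, y i * q i) ^ 2 := by
  have h1 : ∀ i m, (a i m + (if i = m then c else 0) + y i * q m)
        * (a m i + (if m = i then c else 0) + y m * q i)
      = a i m * a m i + (if i = m then 2 * c * a i m + c ^ 2 + 2 * c * (y i * q i) else 0)
        + (q i * (y m * a i m) + q m * (y i * a m i)) + (y i * q i) * (y m * q m) := by
    intro i m
    by_cases him : i = m
    · subst him
      simp only [if_true]
      ring
    · simp only [if_neg him, if_neg (Ne.symm him)]
      ring
  simp only [h1, Finset.sum_add_distrib, Finset.sum_ite_eq, Finset.mem_univ, if_true]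
  rw [Finset.sum_comm (f := fun i m => q m * (y i * a m i))]
  simp only [← Finset.mul_sum, ← Finset.sum_mul, Finset.sum_const, Finset.card_univ,
    Fintype.card_fin, nsmul_eq_mul]
  ring

/-- The change of the Ricci curvature under a projective change `Gⁱ = Aⁱ + P yⁱ` of sprays. -/
theorem sprayRicci_projective (hD : IsOpen D) (hA : ∀ i, ContDiffOn ℝ ∞ (A i) D)
    (hP : ContDiffOn ℝ ∞ P D) (hcone : ∀ q ∈ D, ∀ t : ℝ, 0 < t → (q.1, t • q.2) ∈ D)
    (hAh : ∀ i, IsYHomogeneous D 2 (A i)) (hPh : IsYHomogeneous D 1 P)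
    (hG : ∀ i, ∀ q ∈ D, G i q = A i q + P q * q.2 i) (hp : p ∈ D) :
    sprayRicci G p = sprayRicci A p + (n - 1) *
      (P p ^ 2 - (∑ k, p.2 k * dx k P p - 2 * ∑ k, A k p * dy k P p)) := by
  have hGs : ∀ i, ContDiffOn ℝ ∞ (G i) D := fun i =>
    ((hA i).add (hP.mul (contDiff_coord i).contDiffOn)).congr (hG i)
  have dA : ∀ i, ∀ q ∈ D, DifferentiableAt ℝ (A i) q := fun i q hq =>
    ContDiffOn.differentiableAt_of_isOpen hD (hA i) hq
  have dP : ∀ q ∈ D, DifferentiableAt ℝ P q := fun q hq =>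
    ContDiffOn.differentiableAt_of_isOpen hD hP hq
  have hAhom : ∀ i, ∀ q ∈ D, ∑ k, q.2 k * dy k (A i) q = 2 * A i q := fun i q hq => by
    rw [sum_coord_mul_dy, (hAh i).euler hq (dA i q hq), Nat.cast_ofNat]
  have hPhom : ∀ q ∈ D, ∑ k, q.2 k * dy k P q = P q := fun q hq => by
    rw [sum_coord_mul_dy, hPh.euler hq (dP q hq), Nat.cast_one, one_mul]
  have hdx : ∀ i k, dx k (G i) p = dx k (A i) p + p.2 i * dx k P p := fun i k => by
    rw [dx_congr hD hp (hG i), dx_add_mul_coord (dA i p hp) (dP p hp)]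
  have hdy : ∀ i k, ∀ q ∈ D,
      dy k (G i) q = dy k (A i) q + (if i = k then P q else 0) + q.2 i * dy k P q :=
    fun i k q hq => by rw [dy_congr hD hq (hG i), dy_add_mul_coord (dA i q hq) (dP q hq)]
  -- The diagonal contributes `n P`, and Euler's relation for `P` one more `P`.
  have hdiv : ∀ q ∈ D, sprayDiv G q = sprayDiv A q + (n + 1) * P q := by
    intro q hq
    simp only [sprayDiv, hdy _ _ q hq, if_true, Finset.sum_add_distrib, hPhom q hq,
      Finset.sum_const, Finset.card_univ, Fintype.card_fin, nsmul_eq_mul]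
    ring
  have hdivA : DifferentiableAt ℝ (sprayDiv A) p := by
    have : ContDiffOn ℝ ∞ (sprayDiv A) D :=
      ContDiffOn.sum fun i _ => contDiffOn_dy hD (hA i) i
    exact ContDiffOn.differentiableAt_of_isOpen hD this hp
  have hdivx : ∀ k, dx k (sprayDiv G) p = dx k (sprayDiv A) p + (n + 1) * dx k P p := fun k => by
    rw [dx_congr hD hp hdiv, dx_add_const_mul hdivA (dP p hp)]
  have hdivy : ∀ k, dy k (sprayDiv G) p = dy k (sprayDiv A) p + (n + 1) * dy k P p := fun k => by
    rw [dy_congr hD hp hdiv, dy_add_const_mul hdivA (dP p hp)]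
  have hdivhom : ∑ k, p.2 k * dy k (sprayDiv A) p = sprayDiv A p := by
    have hh : IsYHomogeneous D 1 (sprayDiv A) := fun q hq t ht => by
      rw [sprayDiv, sprayDiv, Finset.mul_sum]
      exact Finset.sum_congr rfl fun i _ => (hAh i).dy hD hcone (dA i) i q hq t ht
    rw [sum_coord_mul_dy, hh.euler hp hdivA, Nat.cast_one, one_mul]
  rw [sprayRicci_eq hD hGs hp, sprayRicci_eq hD hA hp]
  simp only [hdx, hdivx, hdivy, hdy _ _ p hp, sum_mul_transpose, hG _ p hp]
  simp only [hAhom _ p hp, hPhom p hp, mul_add, add_mul, Finset.sum_add_distrib]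
  have e1 : ∑ m, P p * p.2 m * dy m (sprayDiv A) p = P p * sprayDiv A p := by
    rw [← hdivhom, Finset.mul_sum]
    exact Finset.sum_congr rfl fun m _ => by ring
  have e2 : ∑ m, P p * p.2 m * (n * dy m P p) = n * P p ^ 2 := by
    have : ∀ m, P p * p.2 m * (n * dy m P p) = n * P p * (p.2 m * dy m P p) := fun m => by ring
    simp only [this, ← Finset.mul_sum, hPhom p hp]
    ring
  have e3 : ∑ m, P p * p.2 m * (1 * dy m P p) = P p ^ 2 := by
    have : ∀ m, P p * p.2 m * (1 * dy m P p) = P p * (p.2 m * dy m P p) := fun m => by ring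
    simp only [this, ← Finset.mul_sum, hPhom p hp]
    ring
  have e4 : ∑ m, p.2 m * (n * dx m P p) = n * ∑ m, p.2 m * dx m P p := by
    rw [Finset.mul_sum]
    exact Finset.sum_congr rfl fun m _ => by ring
  have e5 : ∑ m, A m p * (n * dy m P p) = n * ∑ m, A m p * dy m P p := by
    rw [Finset.mul_sum]
    exact Finset.sum_congr rfl fun m _ => by ring
  have e6 : ∑ m, dy m P p * (2 * A m p) = 2 * ∑ m, A m p * dy m P p := by
    rw [Finset.mul_sum]
    exact Finset.sum_congr rfl fun m _ => by ring
  rw [e1, e2, e3, e4, e5, e6]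
  simp only [one_mul]
  have e7 : ∑ i, dy i (A i) p = sprayDiv A p := rfl
  rw [e7]
  ring

end Projective

/-! ### First and second derivatives of `F²` -/

section KropinaSpray

variable {n : ℕ} {h : Coord n → Coord n →L[ℝ] Coord n →L[ℝ] ℝ} {b : Coord n → Coord n →L[ℝ] ℝ}
  {w : Coord n → Coord n} {U : Set (Coord n)}

/-- Reduces directional derivatives to one variable, where the product and quotient rules give
scalar identities. -/
theorem hasDerivAt_line {f : Coord n × Coord n → ℝ} {p : Coord n × Coord n}
    (hf : DifferentiableAt ℝ f p) (d : Coord n × Coord n) :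
    HasDerivAt (fun t : ℝ => f (p + t • d)) (fderiv ℝ f p d) 0 := by
  have h1 : HasDerivAt (fun t : ℝ => p + t • d) d 0 := by
    simpa using ((hasDerivAt_id (0 : ℝ)).smul_const d).const_add p
  have h2 : HasFDerivAt f (fderiv ℝ f p) (p + (0 : ℝ) • d) := by simpa using hf.hasFDerivAt
  exact h2.comp_hasDerivAt (0 : ℝ) h1

variable (h b) in
/-- The derivative of the square of the Kropina metric in the fibre direction `z`. -/
def kropinaSqDeriv (z : Coord n) (p : Coord n × Coord n) : ℝ :=
  4 * (metricSq h p * h p.1 p.2 z) * ((b p.1 p.2)⁻¹ * (b p.1 p.2)⁻¹)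
    - 2 * (metricSq h p * metricSq h p * b p.1 z)
      * ((b p.1 p.2)⁻¹ * (b p.1 p.2)⁻¹ * (b p.1 p.2)⁻¹)

namespace IsUnitKropina

theorem differentiableAt_metric (H : IsUnitKropina U h b w) {x : Coord n} (hx : x ∈ U) :
    DifferentiableAt ℝ h x :=
  (H.contDiffOn_metric.contDiffAt (H.isOpen.mem_nhds hx)).differentiableAt (by simp)

theorem differentiableAt_form (H : IsUnitKropina U h b w) {x : Coord n} (hx : x ∈ U) :
    DifferentiableAt ℝ b x :=
  (H.contDiffOn_form.contDiffAt (H.isOpen.mem_nhds hx)).differentiableAt (by simp)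

theorem yRational_metric_apply (H : IsUnitKropina U h b w) (z : Coord n) :
    YRational U b fun p => h p.1 p.2 z :=
  .oneForm (c := fun x => (h x).flip z)
    ((contDiffOn_flip H.contDiffOn_metric).clm_apply contDiffOn_const)

theorem yRational_form_apply (H : IsUnitKropina U h b w) (z : Coord n) :
    YRational U b fun p => b p.1 z :=
  .coeff (c := fun x => b x z) (H.contDiffOn_form.clm_apply contDiffOn_const)

theorem yRational_kropinaSqDeriv (H : IsUnitKropina U h b w) (z : Coord n) :
    YRational U b (kropinaSqDeriv h b z) :=
  (((YRational.const 4).mul (H.yRational_metricSq.mul (H.yRational_metric_apply z))).mul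
    (.mul .inv .inv)).sub
    (((YRational.const 2).mul ((H.yRational_metricSq.mul H.yRational_metricSq).mul
      (H.yRational_form_apply z))).mul (.mul (.mul .inv .inv) .inv))

variable {p : Coord n × Coord n}

theorem differentiableAt (H : IsUnitKropina U h b w) {f : Coord n × Coord n → ℝ}
    (hf : YRational U b f) (hp : p ∈ posDomain U b) : DifferentiableAt ℝ f p :=
  hf.differentiableAt H.isOpen H.contDiffOn_form hp

theorem hasFDerivAt_metric_fst (H : IsUnitKropina U h b w) (hp : p.1 ∈ U) :
    HasFDerivAt (fun q : Coord n × Coord n => h q.1)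
      ((fderiv ℝ h p.1).comp (ContinuousLinearMap.fst ℝ (Coord n) (Coord n))) p :=
  (H.differentiableAt_metric hp).hasFDerivAt.comp p hasFDerivAt_fst

theorem fderiv_metric_apply (H : IsUnitKropina U h b w) (hp : p.1 ∈ U) (z : Coord n)
    (d : Coord n × Coord n) : fderiv ℝ (fun q : Coord n × Coord n => h q.1 q.2 z) p d =
      fderiv ℝ h p.1 d.1 p.2 z + h p.1 d.2 z := by
  have := ((H.hasFDerivAt_metric_fst hp).clm_apply hasFDerivAt_snd).clm_apply
    (hasFDerivAt_const z p)
  rw [this.fderiv]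
  simp [add_comm]

theorem fderiv_metricSq (H : IsUnitKropina U h b w) (hp : p.1 ∈ U) (d : Coord n × Coord n) :
    fderiv ℝ (metricSq h) p d = fderiv ℝ h p.1 d.1 p.2 p.2 + 2 * h p.1 p.2 d.2 := by
  have := ((H.hasFDerivAt_metric_fst hp).clm_apply hasFDerivAt_snd).clm_apply hasFDerivAt_snd
  have h1 : fderiv ℝ (metricSq h) p = _ := this.fderiv
  rw [h1]
  simp [H.symm _ hp d.2 p.2]
  ring

theorem fderiv_form (H : IsUnitKropina U h b w) (hp : p.1 ∈ U) (d : Coord n × Coord n) :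
    fderiv ℝ (fun q : Coord n × Coord n => b q.1 q.2) p d =
      fderiv ℝ b p.1 d.1 p.2 + b p.1 d.2 :=
  YRational.fderiv_oneForm (H.differentiableAt_form hp) d

theorem fderiv_form_apply (H : IsUnitKropina U h b w) (hp : p.1 ∈ U) (z : Coord n)
    (d : Coord n × Coord n) : fderiv ℝ (fun q : Coord n × Coord n => b q.1 z) p d =
      fderiv ℝ b p.1 d.1 z := by
  have h1 : HasFDerivAt (fun q : Coord n × Coord n => b q.1) _ p :=
    (H.differentiableAt_form hp).hasFDerivAt.comp p hasFDerivAt_fst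
  rw [(h1.clm_apply (hasFDerivAt_const z p)).fderiv]
  simp

/-- With the four ingredient derivatives left as parameters, one computation serves both the fibre
directions (fundamental tensor) and the spray direction (Euler–Lagrange). -/
theorem fderiv_kropinaSqDeriv (H : IsUnitKropina U h b w) (hp : p ∈ posDomain U b) (z : Coord n)
    (d : Coord n × Coord n) {L' β' m' c' : ℝ} (hL : fderiv ℝ (metricSq h) p d = L')
    (hβ : fderiv ℝ (fun q : Coord n × Coord n => b q.1 q.2) p d = β')
    (hm : fderiv ℝ (fun q : Coord n × Coord n => h q.1 q.2 z) p d = m')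
    (hc : fderiv ℝ (fun q : Coord n × Coord n => b q.1 z) p d = c') :
    fderiv ℝ (kropinaSqDeriv h b z) p d =
      4 * (L' * h p.1 p.2 z + metricSq h p * m') / b p.1 p.2 ^ 2
        - 8 * metricSq h p * h p.1 p.2 z * β' / b p.1 p.2 ^ 3
        - (4 * metricSq h p * L' * b p.1 z + 2 * metricSq h p ^ 2 * c') / b p.1 p.2 ^ 3
        + 6 * metricSq h p ^ 2 * b p.1 z * β' / b p.1 p.2 ^ 4 := by
  have hb := hp.2.ne'
  have e1 := hasDerivAt_line (H.differentiableAt H.yRational_metricSq hp) d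
  have e2 := hasDerivAt_line (H.differentiableAt H.yRational_form hp) d
  have e3 := hasDerivAt_line (H.differentiableAt (H.yRational_metric_apply z) hp) d
  have e4 := hasDerivAt_line (H.differentiableAt (H.yRational_form_apply z) hp) d
  have e5 := hasDerivAt_line (H.differentiableAt (H.yRational_kropinaSqDeriv z) hp) d
  have e6 := e2.fun_inv (by simpa using hb)
  rw [hL] at e1
  rw [hβ] at e6
  rw [hm] at e3
  rw [hc] at e4
  have e7 := (((e1.mul e3).const_mul 4).mul (e6.mul e6)).sub
    ((((e1.mul e1).mul e4).const_mul 2).mul ((e6.mul e6).mul e6))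
  rw [e5.unique e7]
  simp only [zero_smul, add_zero, Pi.mul_apply]
  field_simp
  ring

end IsUnitKropina

end KropinaSpray

/-! ### Gram matrices and rank-two perturbations -/

section Gram

variable {n : ℕ}

/-- The matrix of a bilinear form on the coordinate space. -/
def gramMatrix (B : Coord n →L[ℝ] Coord n →L[ℝ] ℝ) : Matrix (Fin n) (Fin n) ℝ :=
  Matrix.of fun i j => B (EuclideanSpace.single i 1) (EuclideanSpace.single j 1)

theorem gramMatrix_mulVec (B : Coord n →L[ℝ] Coord n →L[ℝ] ℝ) (y : Coord n) (i : Fin n) :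
    ∑ j, gramMatrix B i j * y j = B (EuclideanSpace.single i 1) y := by
  conv_rhs => rw [YRational.eq_sum_single y]
  simp [gramMatrix, mul_comm]

theorem sum_mul_apply_single (φ : Coord n →L[ℝ] ℝ) (y : Coord n) :
    ∑ i, y i * φ (EuclideanSpace.single i 1) = φ y := by
  conv_rhs => rw [YRational.eq_sum_single y]
  simp

theorem gramMatrix_posDef {B : Coord n →L[ℝ] Coord n →L[ℝ] ℝ} (hs : ∀ v z, B v z = B z v)
    (hB : ∀ v, v ≠ 0 → 0 < B v v) : (gramMatrix B).PosDef := by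
  rw [Matrix.posDef_iff_dotProduct_mulVec]
  refine ⟨by ext i j; simp [gramMatrix, hs (EuclideanSpace.single j 1)], fun {x} hx => ?_⟩
  have h1 : WithLp.toLp 2 x ≠ (0 : Coord n) := by
    intro h0
    apply hx
    ext i
    simpa using congrArg (fun v : Coord n => v i) h0
  refine (hB _ h1).trans_eq ?_
  simp only [dotProduct, Matrix.mulVec, star_trivial]
  have h2 := fun i => gramMatrix_mulVec B (WithLp.toLp 2 x) i
  simp only at h2
  simp only [h2]
  have h3 := sum_mul_apply_single (B.flip (WithLp.toLp 2 x)) (WithLp.toLp 2 x)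
  simpa using h3.symm

/-- The determinant of a modification of a bilinear form by products of the one-forms dual to two
vectors. -/
theorem det_gramMatrix_add {B : Coord n →L[ℝ] Coord n →L[ℝ] ℝ} (hs : ∀ v z, B v z = B z v)
    (y w : Coord n) (c₁ c₂ c₃ : ℝ) :
    (Matrix.of fun i j => gramMatrix B i j
      + c₁ * B y (EuclideanSpace.single i 1) * B y (EuclideanSpace.single j 1)
      + c₂ * (B y (EuclideanSpace.single i 1) * B w (EuclideanSpace.single j 1)
        + B w (EuclideanSpace.single i 1) * B y (EuclideanSpace.single j 1))
      + c₃ * B w (EuclideanSpace.single i 1) * B w (EuclideanSpace.single j 1)).det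
    = (gramMatrix B).det * ((1 + c₁ * B y y + c₂ * B y w) * (1 + c₂ * B y w + c₃ * B w w)
      - (c₁ * B y w + c₂ * B w w) * (c₂ * B y y + c₃ * B y w)) := by
  set Y : Matrix (Fin n) (Fin 2) ℝ := Matrix.of fun i a => ![y i, w i] a with hY
  set C : Matrix (Fin 2) (Fin 2) ℝ := !![c₁, c₂; c₂, c₃] with hC
  set V : Matrix (Fin 2) (Fin n) ℝ := Matrix.of fun a j =>
    ![B y (EuclideanSpace.single j 1), B w (EuclideanSpace.single j 1)] a with hV
  have h1 : gramMatrix B * Y = V.transpose := by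
    ext i a
    fin_cases a
    · simpa [Matrix.mul_apply, hY, hV, hs y] using gramMatrix_mulVec B y i
    · simpa [Matrix.mul_apply, hY, hV, hs w] using gramMatrix_mulVec B w i
  have h2 : V * Y = !![B y y, B y w; B y w, B w w] := by
    have e : ∀ u v : Coord n, ∑ i, B u (EuclideanSpace.single i 1) * v i = B u v := fun u v => by
      rw [← sum_mul_apply_single (B u) v]
      exact Finset.sum_congr rfl fun i _ => mul_comm _ _
    ext a c
    fin_cases a <;> fin_cases c <;> simp [Matrix.mul_apply, hY, hV, e, hs w y]
  have h3 : (Matrix.of fun i j => gramMatrix B i j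
      + c₁ * B y (EuclideanSpace.single i 1) * B y (EuclideanSpace.single j 1)
      + c₂ * (B y (EuclideanSpace.single i 1) * B w (EuclideanSpace.single j 1)
        + B w (EuclideanSpace.single i 1) * B y (EuclideanSpace.single j 1))
      + c₃ * B w (EuclideanSpace.single i 1) * B w (EuclideanSpace.single j 1))
      = gramMatrix B * (1 + Y * (C * V)) := by
    rw [Matrix.mul_add, Matrix.mul_one, ← Matrix.mul_assoc, h1]
    ext i j
    simp [Matrix.mul_apply, hC, hV, Fin.sum_univ_two, Matrix.vecHead, Matrix.vecTail]
    ring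
  -- Sylvester's identity replaces the `n × n` determinant of `1 + Y(CV)` by a `2 × 2` one.
  rw [h3, Matrix.det_mul, Matrix.det_one_add_mul_comm, Matrix.mul_assoc, h2, Matrix.det_fin_two]
  congr 1
  simp [hC]
  ring

end Gram

/-! ### Fundamental tensor, its determinant, and the geodesic coefficients -/

section KropinaSpray

variable {n : ℕ} {h : Coord n → Coord n →L[ℝ] Coord n →L[ℝ] ℝ} {b : Coord n → Coord n →L[ℝ] ℝ}
  {w : Coord n → Coord n} {U : Set (Coord n)} {F : Coord n × Coord n → ℝ} {p : Coord n × Coord n}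

namespace IsUnitKropina

/-- The reduced spray preserves `b(y)`, so only the term `-2P b(y)` remains. By the next lemma
`h(y,y)` has the same logarithmic rate, in accordance with `F` being constant along its geodesics.
-/
theorem fderiv_form_spray (H : IsUnitKropina U h b w) (hp : p ∈ posDomain U b) :
    fderiv ℝ (fun q : Coord n × Coord n => b q.1 q.2) p (p.2, (-2 : ℝ) • kropinaSpray h b w p) =
      -(sprayRate h b w p * b p.1 p.2 / metricSq h p) := by
  have hL := (H.metricSq_pos hp).ne'
  have h1 := H.form_reducedSpray hp
  rw [H.fderiv_form hp.1, ← h1]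
  simp only [kropinaSpray, map_smul, map_add, smul_eq_mul, sprayFactor]
  field_simp
  ring

theorem fderiv_metricSq_spray (H : IsUnitKropina U h b w) (hp : p ∈ posDomain U b) :
    fderiv ℝ (metricSq h) p (p.2, (-2 : ℝ) • kropinaSpray h b w p) = -sprayRate h b w p := by
  have hL := (H.metricSq_pos hp).ne'
  have h1 := H.metric_reducedSpray_self hp
  rw [H.symm _ hp.1] at h1
  have h2 : h p.1 p.2 p.2 = metricSq h p := rfl
  rw [H.fderiv_metricSq hp.1]
  simp only [kropinaSpray, map_smul, map_add, smul_eq_mul, sprayFactor, h2]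
  field_simp
  linarith

theorem fderiv_metricSq_reducedSpray (H : IsUnitKropina U h b w) (hp : p ∈ posDomain U b) :
    fderiv ℝ (metricSq h) p (p.2, (-2 : ℝ) • reducedSpray h b w p) = sprayRate h b w p := by
  have h1 := H.metric_reducedSpray_self hp
  rw [H.symm _ hp.1] at h1
  rw [H.fderiv_metricSq hp.1]
  simp only [map_smul, smul_eq_mul]
  linarith

/-- The square of the Kropina metric is differentiable, with the expected derivative. -/
theorem fderiv_sq (H : IsUnitKropina U h b w)
    (hF : ∀ q ∈ posDomain U b, F q = metricSq h q / b q.1 q.2) (hp : p ∈ posDomain U b)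
    (d : Coord n × Coord n) : fderiv ℝ (fun q => F q ^ 2) p d =
      2 * metricSq h p * fderiv ℝ (metricSq h) p d / b p.1 p.2 ^ 2
        - 2 * metricSq h p ^ 2 * fderiv ℝ (fun q : Coord n × Coord n => b q.1 q.2) p d
          / b p.1 p.2 ^ 3 := by
  have hb := hp.2.ne'
  have hR : YRational U b fun q =>
      (metricSq h q * (b q.1 q.2)⁻¹) * (metricSq h q * (b q.1 q.2)⁻¹) :=
    .mul (H.yRational_metricSq.mul .inv) (H.yRational_metricSq.mul .inv)
  have h1 : (fun q => F q ^ 2) =ᶠ[nhds p]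
      fun q => (metricSq h q * (b q.1 q.2)⁻¹) * (metricSq h q * (b q.1 q.2)⁻¹) :=
    Filter.eventuallyEq_of_mem (H.isOpen_posDomain.mem_nhds hp) fun q hq => by
      simp only [hF q hq]
      ring
  rw [h1.fderiv_eq]
  have e1 := hasDerivAt_line (H.differentiableAt H.yRational_metricSq hp) d
  have e2 := (hasDerivAt_line (H.differentiableAt H.yRational_form hp) d).fun_inv
    (by simpa using hb)
  have e3 := (e1.mul e2).mul (e1.mul e2)
  rw [(hasDerivAt_line (H.differentiableAt hR hp) d).unique e3]
  simp only [zero_smul, add_zero, Pi.mul_apply]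
  field_simp
  ring

theorem dy_sq (H : IsUnitKropina U h b w)
    (hF : ∀ q ∈ posDomain U b, F q = metricSq h q / b q.1 q.2) (hp : p ∈ posDomain U b)
    (l : Fin n) : dy l (fun q => F q ^ 2) p =
      kropinaSqDeriv h b (EuclideanSpace.single l 1) p := by
  have hb := hp.2.ne'
  rw [dy, H.fderiv_sq hF hp, H.fderiv_metricSq hp.1, H.fderiv_form hp.1, kropinaSqDeriv]
  simp only [map_zero, zero_apply, zero_add]
  field_simp
  ring

theorem fderiv_dy_sq (H : IsUnitKropina U h b w)
    (hF : ∀ q ∈ posDomain U b, F q = metricSq h q / b q.1 q.2) (hp : p ∈ posDomain U b)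
    (l : Fin n) : fderiv ℝ (dy l fun q => F q ^ 2) p =
      fderiv ℝ (kropinaSqDeriv h b (EuclideanSpace.single l 1)) p :=
  Filter.EventuallyEq.fderiv_eq
    (Filter.eventuallyEq_of_mem (H.isOpen_posDomain.mem_nhds hp) fun _ hq => H.dy_sq hF hq l)

theorem fundTensor_apply (H : IsUnitKropina U h b w)
    (hF : ∀ q ∈ posDomain U b, F q = metricSq h q / b q.1 q.2) (hp : p ∈ posDomain U b) :
    fundTensor F p = (2 * metricSq h p / b p.1 p.2 ^ 2) • Matrix.of fun i j =>
      gramMatrix (h p.1) i j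
      + 2 / metricSq h p * h p.1 p.2 (EuclideanSpace.single i 1)
        * h p.1 p.2 (EuclideanSpace.single j 1)
      + -2 / b p.1 p.2 * (h p.1 p.2 (EuclideanSpace.single i 1)
          * h p.1 (w p.1) (EuclideanSpace.single j 1)
        + h p.1 (w p.1) (EuclideanSpace.single i 1) * h p.1 p.2 (EuclideanSpace.single j 1))
      + 3 * metricSq h p / (2 * b p.1 p.2 ^ 2) * h p.1 (w p.1) (EuclideanSpace.single i 1)
        * h p.1 (w p.1) (EuclideanSpace.single j 1) := by
  have hb := hp.2.ne'
  have hL := (H.metricSq_pos hp).ne'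
  ext i j
  simp only [fundTensor, Matrix.of_apply, Matrix.smul_apply, smul_eq_mul]
  rw [dy, H.fderiv_dy_sq hF hp, H.fderiv_kropinaSqDeriv hp _ _ rfl rfl rfl rfl,
    H.fderiv_metricSq hp.1, H.fderiv_form hp.1, H.fderiv_metric_apply hp.1,
    H.fderiv_form_apply hp.1]
  simp only [map_zero, zero_apply, zero_add, H.dual _ hp.1, gramMatrix, Matrix.of_apply]
  field_simp
  ring

theorem det_fundTensor (H : IsUnitKropina U h b w)
    (hF : ∀ q ∈ posDomain U b, F q = metricSq h q / b q.1 q.2) (hp : p ∈ posDomain U b) :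
    (fundTensor F p).det = (2 * metricSq h p / b p.1 p.2 ^ 2) ^ n *
      ((gramMatrix (h p.1)).det * (metricSq h p / (2 * b p.1 p.2 ^ 2))) := by
  have hb := hp.2.ne'
  have hL := (H.metricSq_pos hp).ne'
  have h1 : h p.1 p.2 (w p.1) = b p.1 p.2 := by rw [H.symm _ hp.1, H.dual _ hp.1]
  have h2 : h p.1 p.2 p.2 = metricSq h p := rfl
  rw [H.fundTensor_apply hF hp, Matrix.det_smul, det_gramMatrix_add (H.symm _ hp.1), h1, h2,
    H.dual _ hp.1, H.unit _ hp.1, Fintype.card_fin]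
  congr 2
  field_simp
  ring

theorem det_gramMatrix_pos (H : IsUnitKropina U h b w) {x : Coord n} (hx : x ∈ U) :
    0 < (gramMatrix (h x)).det :=
  (gramMatrix_posDef (H.symm x hx) (H.pos x hx)).det_pos

theorem det_fundTensor_pos (H : IsUnitKropina U h b w)
    (hF : ∀ q ∈ posDomain U b, F q = metricSq h q / b q.1 q.2) (hp : p ∈ posDomain U b) :
    0 < (fundTensor F p).det := by
  have hb := hp.2
  have hL := H.metricSq_pos hp
  have := H.det_gramMatrix_pos hp.1
  rw [H.det_fundTensor hF hp]
  positivity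

/-- The Euler–Lagrange equations. -/
theorem fderiv_kropinaSqDeriv_spray (H : IsUnitKropina U h b w)
    (hF : ∀ q ∈ posDomain U b, F q = metricSq h q / b q.1 q.2) (hp : p ∈ posDomain U b)
    (z : Coord n) : fderiv ℝ (kropinaSqDeriv h b z) p (p.2, (-2 : ℝ) • kropinaSpray h b w p) =
      fderiv ℝ (fun q => F q ^ 2) p (z, 0) := by
  have hb := hp.2.ne'
  have hL := (H.metricSq_pos hp).ne'
  have hm : fderiv ℝ (fun q : Coord n × Coord n => h q.1 q.2 z) p
      (p.2, (-2 : ℝ) • kropinaSpray h b w p) = fderiv ℝ h p.1 p.2 p.2 z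
        - 2 * (sprayForm h b w p z + sprayFactor h b w p * h p.1 p.2 z) := by
    rw [H.fderiv_metric_apply hp.1, ← H.metric_reducedSpray hp]
    simp [kropinaSpray]
    ring
  rw [H.fderiv_kropinaSqDeriv hp z _ (H.fderiv_metricSq_spray hp) (H.fderiv_form_spray hp) hm
    (H.fderiv_form_apply hp.1 z _), H.fderiv_sq hF hp, H.fderiv_metricSq hp.1, H.fderiv_form hp.1,
    sprayForm_apply, sprayFactor]
  simp only [map_zero, add_zero, mul_zero]
  generalize sprayRate h b w p = μ at *
  field_simp
  ring

/-- The Euler–Lagrange equations say that `4 g` applied to the candidate spray is the bracket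
defining `Gⁱ`; nondegeneracy of `g` then identifies the two. -/
theorem geodCoeff_eq (H : IsUnitKropina U h b w)
    (hF : ∀ q ∈ posDomain U b, F q = metricSq h q / b q.1 q.2) (hp : p ∈ posDomain U b)
    (i : Fin n) : geodCoeff F i p = kropinaSpray h b w p i := by
  have hsymm : ∀ i j, fundTensor F p i j = fundTensor F p j i := by
    intro i j
    rw [H.fundTensor_apply hF hp]
    simp only [Matrix.smul_apply, Matrix.of_apply, gramMatrix,
      H.symm _ hp.1 (EuclideanSpace.single i 1) (EuclideanSpace.single j 1), smul_eq_mul]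
    ring
  have h1 : ∀ l, (∑ k, dx k (dy l fun q => F q ^ 2) p * p.2 k) - dx l (fun q => F q ^ 2) p =
      4 * ∑ m, fundTensor F p l m * kropinaSpray h b w p m := by
    intro l
    have e1 : ∑ k, dx k (dy l fun q => F q ^ 2) p * p.2 k =
        fderiv ℝ (kropinaSqDeriv h b (EuclideanSpace.single l 1)) p (p.2, 0) := by
      rw [← H.fderiv_dy_sq hF hp, ← sum_coord_mul_dx]
      exact Finset.sum_congr rfl fun k _ => mul_comm _ _
    have e2 : ∑ m, fundTensor F p l m * kropinaSpray h b w p m = (1 / 2) *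
        fderiv ℝ (kropinaSqDeriv h b (EuclideanSpace.single l 1)) p
          (0, kropinaSpray h b w p) := by
      rw [← H.fderiv_dy_sq hF hp, ← sum_coord_mul_dy, Finset.mul_sum]
      refine Finset.sum_congr rfl fun m _ => ?_
      rw [hsymm]
      simp only [fundTensor, Matrix.of_apply]
      ring
    have e3 : (p.2, (-2 : ℝ) • kropinaSpray h b w p) =
        (p.2, 0) + (-2 : ℝ) • ((0 : Coord n), kropinaSpray h b w p) := by simp
    have e4 := H.fderiv_kropinaSqDeriv_spray hF hp (EuclideanSpace.single l 1)
    rw [e3, map_add, map_smul, smul_eq_mul] at e4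
    rw [e1, e2, dx, ← e4]
    ring
  have hdet : IsUnit (fundTensor F p).det := (H.det_fundTensor_pos hF hp).ne'.isUnit
  have h2 : ((fundTensor F p)⁻¹).mulVec ((fundTensor F p).mulVec (kropinaSpray h b w p)) i =
      kropinaSpray h b w p i := by
    rw [Matrix.mulVec_mulVec, Matrix.nonsing_inv_mul _ hdet, Matrix.one_mulVec]
  rw [← h2, geodCoeff]
  simp only [h1, Matrix.mulVec, dotProduct, Finset.mul_sum]
  refine Finset.sum_congr rfl fun l _ => Finset.sum_congr rfl fun m _ => ?_
  ring

end IsUnitKropina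

end KropinaSpray

/-! ### The Einstein condition forces `sprayRate` to vanish -/

section Einstein

variable {n : ℕ} {h : Coord n → Coord n →L[ℝ] Coord n →L[ℝ] ℝ} {b : Coord n → Coord n →L[ℝ] ℝ}
  {w : Coord n → Coord n} {U : Set (Coord n)} {F : Coord n × Coord n → ℝ} {p : Coord n × Coord n}

theorem smul_mem_posDomain {q : Coord n × Coord n} (hq : q ∈ posDomain U b) {t : ℝ} (ht : 0 < t) :
    (q.1, t • q.2) ∈ posDomain U b :=
  ⟨hq.1, by simpa using mul_pos ht hq.2⟩

theorem sprayRate_smul (x y : Coord n) (t : ℝ) :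
    sprayRate h b w (x, t • y) = t ^ 3 * sprayRate h b w (x, y) := by
  simp only [sprayRate, metricSq, curlForm, killingDefect, map_smul, smul_apply, smul_eq_mul]
  ring

theorem sprayForm_smul (x y : Coord n) {t : ℝ} (ht : t ≠ 0) :
    sprayForm h b w (x, t • y) = t ^ 2 • sprayForm h b w (x, y) := by
  ext z
  simp only [sprayForm_apply, sprayRate_smul, smul_apply]
  simp only [metricSq, map_smul, smul_apply, smul_eq_mul, mul_inv]
  field_simp

theorem reducedSpray_smul (x y : Coord n) {t : ℝ} (ht : t ≠ 0) :
    reducedSpray h b w (x, t • y) = t ^ 2 • reducedSpray h b w (x, y) := by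
  simp only [reducedSpray, sprayForm_smul x y ht, sharp, map_smul]

theorem sprayFactor_smul (x y : Coord n) {t : ℝ} (ht : t ≠ 0) :
    sprayFactor h b w (x, t • y) = t * sprayFactor h b w (x, y) := by
  simp only [sprayFactor, sprayRate_smul]
  simp only [metricSq, map_smul, smul_apply, smul_eq_mul]
  field_simp

/-- If `1 + c t²` divides a nonzero multiple of the square of
`-(1 + c t²) k t - 2 (-k t + r t²)`, then `k` and `r` vanish. -/
theorem eq_zero_of_sq_eq_mul {c k r : ℝ} (hc : 0 < c) {a : ℝ} (ha : a ≠ 0) {q : Polynomial ℝ}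
    (hq : ∀ t : ℝ, a * (-((1 + c * t ^ 2) * (t * k)) - 2 * (-(t * k) + t ^ 2 * r)) ^ 2 =
      (1 + c * t ^ 2) * q.eval t) : k = 0 ∧ r = 0 := by
  have h1 : Polynomial.C a * (-((1 + .C c * .X ^ 2) * (.X * .C k))
      - 2 * (-(.X * .C k) + .X ^ 2 * .C r)) ^ 2 = (1 + .C c * .X ^ 2) * q := by
    refine Polynomial.funext fun t => ?_
    simp only [Polynomial.eval_mul, Polynomial.eval_add, Polynomial.eval_sub, Polynomial.eval_pow,
      Polynomial.eval_neg, Polynomial.eval_C, Polynomial.eval_X, Polynomial.eval_one,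
      Polynomial.eval_ofNat]
    linear_combination hq t
  -- `z = i/√c` is a root of `1 + c t²`; evaluating there kills the right-hand side.
  set s : ℝ := (Real.sqrt c)⁻¹ with hs
  have hs0 : s ≠ 0 := by
    rw [hs]
    exact inv_ne_zero (Real.sqrt_pos.2 hc).ne'
  have hcs : c * s ^ 2 = 1 := by
    rw [hs, inv_pow, Real.sq_sqrt hc.le, mul_inv_cancel₀ hc.ne']
  set z : ℂ := s * Complex.I with hz
  have hcz : 1 + (c : ℂ) * z ^ 2 = 0 := by
    have : (c : ℂ) * (s : ℂ) ^ 2 = 1 := by exact_mod_cast hcs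
    rw [hz, mul_pow, Complex.I_sq]
    linear_combination -this
  have h2 := congrArg (Polynomial.aeval z) h1
  simp only [map_mul, map_add, map_sub, map_neg, map_pow, map_one, map_ofNat, Polynomial.aeval_C,
    Polynomial.aeval_X, Complex.coe_algebraMap, hcz, zero_mul, neg_zero, zero_sub] at h2
  have ha' : (a : ℂ) ≠ 0 := by exact_mod_cast ha
  have hz0 : z ≠ 0 := by
    rw [hz]
    exact mul_ne_zero (by exact_mod_cast hs0) Complex.I_ne_zero
  have h3 : -(z * (k : ℂ)) + z ^ 2 * r = 0 := by
    have := (mul_eq_zero.1 h2).resolve_left ha'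
    have := pow_eq_zero_iff (two_ne_zero) |>.1 this
    linear_combination (-1 / 2 : ℂ) * this
  have h4 : (k : ℂ) = z * r := by
    refine mul_left_cancel₀ hz0 ?_
    linear_combination -h3
  -- Here `k` and `r` are real and `z` is purely imaginary and nonzero, so `k = z r` forces both to
  -- vanish.
  have hre := congrArg Complex.re h4
  have him := congrArg Complex.im h4
  simp [hz] at hre him
  exact ⟨hre, by tauto⟩

namespace IsUnitKropina

theorem yRational_fderiv_reducedSpray (H : IsUnitKropina U h b w) {f : Coord n × Coord n → ℝ}
    (hf : YRational U b f) :
    YRational U b fun p => fderiv ℝ f p (p.2, (-2 : ℝ) • reducedSpray h b w p) := by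
  have h1 : YRational U b fun p => ∑ k, p.2 k * dx k f p
      + (-2) * ∑ k, reducedSpray h b w p k * dy k f p :=
    (YRational.sum _ fun k _ => (YRational.coord k).mul (hf.dx H.isOpen H.contDiffOn_form k)).add
      ((YRational.const _).mul (YRational.sum _ fun k _ =>
        (H.yRational_reducedSpray k).mul (hf.dy H.isOpen H.contDiffOn_form k)))
  refine h1.congr fun p _ => ?_
  have e3 : (p.2, (-2 : ℝ) • reducedSpray h b w p) =
      (p.2, 0) + (-2 : ℝ) • ((0 : Coord n), reducedSpray h b w p) := by simp
  rw [sum_coord_mul_dx, sum_coord_mul_dy, e3, map_add, map_smul, smul_eq_mul]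

theorem yRational_sprayRicci (H : IsUnitKropina U h b w)
    {A : Fin n → Coord n × Coord n → ℝ} (hA : ∀ i, YRational U b (A i)) :
    YRational U b (sprayRicci A) := by
  have hU := H.isOpen
  have hb := H.contDiffOn_form
  refine .sum _ fun i _ => ((((YRational.const 2).mul ((hA i).dx hU hb i)).sub
    (.sum _ fun m _ => (YRational.coord m).mul (((hA i).dy hU hb i).dx hU hb m))).add
    ((YRational.const 2).mul (.sum _ fun m _ => (hA m).mul
      (((hA i).dy hU hb i).dy hU hb m)))).sub
    (.sum _ fun m _ => ((hA i).dy hU hb m).mul ((hA m).dy hU hb i))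

theorem contDiffOn_sprayFactor (H : IsUnitKropina U h b w) :
    ContDiffOn ℝ ∞ (sprayFactor h b w) (posDomain U b) :=
  (H.yRational_sprayRate.contDiffOn H.contDiffOn_form).div
    ((((YRational.const 2).mul H.yRational_metricSq)).contDiffOn H.contDiffOn_form)
    fun _ hp => mul_ne_zero two_ne_zero (H.metricSq_pos hp).ne'

/-- The Ricci curvature of a Kropina metric in terms of that of the reduced spray. -/
theorem ricciCurv_eq (H : IsUnitKropina U h b w)
    (hF : ∀ q ∈ posDomain U b, F q = metricSq h q / b q.1 q.2) (hp : p ∈ posDomain U b) :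
    ricciCurv F p = sprayRicci (fun i q => reducedSpray h b w q i) p + (n - 1) *
      (3 * sprayRate h b w p ^ 2 / (4 * metricSq h p ^ 2)
        - fderiv ℝ (sprayRate h b w) p (p.2, (-2 : ℝ) • reducedSpray h b w p)
          / (2 * metricSq h p)) := by
  have hL := (H.metricSq_pos hp).ne'
  have hD := H.isOpen_posDomain
  rw [ricciCurv_eq_sprayRicci, sprayRicci_projective hD
    (A := fun i q => reducedSpray h b w q i) (P := sprayFactor h b w)
    (fun i => (H.yRational_reducedSpray i).contDiffOn H.contDiffOn_form)
    H.contDiffOn_sprayFactor (fun q hq t ht => smul_mem_posDomain hq ht)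
    (fun i q _ t ht => by
      simp only [reducedSpray_smul _ _ ht.ne', PiLp.smul_apply, smul_eq_mul])
    (fun q _ t ht => by rw [sprayFactor_smul _ _ ht.ne', pow_one])
    (fun i q hq => by rw [H.geodCoeff_eq hF hq]; simp [kropinaSpray]) hp]
  have e3 : (p.2, (-2 : ℝ) • reducedSpray h b w p) =
      (p.2, 0) + (-2 : ℝ) • ((0 : Coord n), reducedSpray h b w p) := by simp
  have e4 : ∑ k, p.2 k * dx k (sprayFactor h b w) p
      - 2 * ∑ k, reducedSpray h b w p k * dy k (sprayFactor h b w) p =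
      fderiv ℝ (sprayFactor h b w) p (p.2, (-2 : ℝ) • reducedSpray h b w p) := by
    rw [sum_coord_mul_dx, sum_coord_mul_dy, e3, map_add, map_smul, smul_eq_mul]
    ring
  -- Quotient rule for `P = μ/(2L)`; along the reduced spray `L' = μ`, hence the second term is
  -- quadratic in `μ`.
  have e5 : fderiv ℝ (sprayFactor h b w) p (p.2, (-2 : ℝ) • reducedSpray h b w p) =
      fderiv ℝ (sprayRate h b w) p (p.2, (-2 : ℝ) • reducedSpray h b w p) / (2 * metricSq h p)
        - sprayRate h b w p ^ 2 / (2 * metricSq h p ^ 2) := by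
    have d1 := hasDerivAt_line (H.differentiableAt H.yRational_sprayRate hp)
      (p.2, (-2 : ℝ) • reducedSpray h b w p)
    have d2 := hasDerivAt_line (H.differentiableAt H.yRational_metricSq hp)
      (p.2, (-2 : ℝ) • reducedSpray h b w p)
    have d3 := hasDerivAt_line
      (ContDiffOn.differentiableAt_of_isOpen hD H.contDiffOn_sprayFactor hp)
      (p.2, (-2 : ℝ) • reducedSpray h b w p)
    rw [H.fderiv_metricSq_reducedSpray hp] at d2
    have d4 := d1.fun_div (d2.const_mul 2) (by simpa using hL)
    rw [d3.unique d4]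
    simp only [zero_smul, add_zero]
    field_simp
  rw [e4, e5, sprayFactor]
  congr 2
  field_simp
  ring

/-- Differentiate the constants `h(w,w) = 1` and `b(w) = 1` and eliminate `b(Dw)`. -/
theorem fderiv_metric_dual (H : IsUnitKropina U h b w) {x : Coord n} (hx : x ∈ U) (z : Coord n) :
    fderiv ℝ h x z (w x) (w x) = 2 * fderiv ℝ b x z (w x) := by
  have hw : HasFDerivAt w (fderiv ℝ w x) x :=
    ((H.contDiffOn_dual.contDiffAt (H.isOpen.mem_nhds hx)).differentiableAt
      (by simp)).hasFDerivAt
  have h1 := ((H.differentiableAt_metric hx).hasFDerivAt.clm_apply hw).clm_apply hw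
  have h2 := (H.differentiableAt_form hx).hasFDerivAt.clm_apply hw
  have c1 : (fun y => h y (w y) (w y)) =ᶠ[nhds x] fun _ => 1 :=
    Filter.eventuallyEq_of_mem (H.isOpen.mem_nhds hx) fun y hy => by
      simp only [H.dual y hy, H.unit y hy]
  have c2 : (fun y => b y (w y)) =ᶠ[nhds x] fun _ => 1 :=
    Filter.eventuallyEq_of_mem (H.isOpen.mem_nhds hx) fun y hy => H.unit y hy
  have e1 := congrArg (fun φ => φ z)
    (h1.unique ((hasFDerivAt_const (1 : ℝ) x).congr_of_eventuallyEq c1))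
  have e2 := congrArg (fun φ => φ z)
    (h2.unique ((hasFDerivAt_const (1 : ℝ) x).congr_of_eventuallyEq c2))
  simp [H.dual x hx, H.symm x hx _ (w x)] at e1 e2
  linarith

/-- Unit length annihilates the `(w,w)` part of the quadratic form and makes its mixed part minus
the curl. So `sprayRate` on the line depends on two numbers besides `h(v,v)`. -/
theorem killingDefect_line (H : IsUnitKropina U h b w) {x : Coord n} (hx : x ∈ U) (v : Coord n)
    (t : ℝ) : killingDefect h b w (x, w x + t • v) =
      -(t * curlForm b w (x, v)) + t ^ 2 * killingDefect h b w (x, v) := by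
  have e1 := H.fderiv_metric_dual hx (w x)
  have e2 := H.fderiv_metric_dual hx v
  have e3 : fderiv ℝ h x (w x) (w x) v = fderiv ℝ h x (w x) v (w x) := by
    have h1 := ((H.differentiableAt_metric hx).hasFDerivAt.clm_apply
      (hasFDerivAt_const (w x) x)).clm_apply (hasFDerivAt_const v x)
    have h2 := ((H.differentiableAt_metric hx).hasFDerivAt.clm_apply
      (hasFDerivAt_const v x)).clm_apply (hasFDerivAt_const (w x) x)
    have c1 : (fun y => h y (w x) v) =ᶠ[nhds x] fun y => h y v (w x) :=
      Filter.eventuallyEq_of_mem (H.isOpen.mem_nhds hx) fun y hy => H.symm y hy _ _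
    have := congrArg (fun φ => φ (w x)) (h1.unique (h2.congr_of_eventuallyEq c1))
    simpa using this
  simp only [killingDefect, curlForm, map_add, map_smul, add_apply, smul_apply, smul_eq_mul]
  rw [e1, e2, e3]
  ring

theorem curlForm_line {x : Coord n} (v : Coord n) (t : ℝ) :
    curlForm b w (x, w x + t • v) = t * curlForm b w (x, v) := by
  simp only [curlForm, map_add, map_smul, add_apply, smul_apply, smul_eq_mul]
  ring

/-- A Kropina metric of Einstein type has the spray `reducedSpray`. -/
theorem sprayRate_eq_zero (H : IsUnitKropina U h b w)
    (hF : ∀ q ∈ posDomain U b, F q = metricSq h q / b q.1 q.2) {σ : Coord n → ℝ}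
    (hE : ∀ q ∈ posDomain U b, ricciCurv F q = σ q.1 * F q ^ 2) (hp : p ∈ posDomain U b) :
    sprayRate h b w p = 0 := by
  obtain ⟨x, y⟩ := p
  have hx : x ∈ U := hp.1
  have hy : 0 < b x y := hp.2
  -- By homogeneity `y` may be rescaled to `b(y) = 1`, which puts it at `t = 1` on the line `w + t
  -- v`.
  obtain ⟨v, hv, hyv⟩ : ∃ v, b x v = 0 ∧ y = b x y • (w x + v) := by
    refine ⟨(b x y)⁻¹ • y - w x, ?_, ?_⟩
    · simp [H.unit x hx, hy.ne']
    · simp [smul_smul, hy.ne']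
  have hb : ∀ t : ℝ, b x (w x + t • v) = 1 := fun t => by simp [hv, H.unit x hx]
  have hline : ∀ t : ℝ, (x, w x + t • v) ∈ posDomain U b := fun t =>
    ⟨hx, by rw [hb]; exact one_pos⟩
  have hL : ∀ t : ℝ, metricSq h (x, w x + t • v) = 1 + h x v v * t ^ 2 := fun t => by
    have : h x v (w x) = 0 := by rw [H.symm x hx, H.dual x hx, hv]
    simp only [metricSq, map_add, map_smul, add_apply, smul_apply, smul_eq_mul, H.dual x hx, hv,
      H.unit x hx, this]
    ring
  have hrate : ∀ t : ℝ, sprayRate h b w (x, w x + t • v) =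
      -((1 + h x v v * t ^ 2) * (t * curlForm b w (x, v)))
        - 2 * (-(t * curlForm b w (x, v)) + t ^ 2 * killingDefect h b w (x, v)) := fun t => by
    rw [sprayRate, hL, curlForm_line, H.killingDefect_line hx]
    simp only [hb]
    ring
  rw [hyv, sprayRate_smul]
  refine mul_eq_zero_of_right _ ?_
  have h1 := hrate 1
  rw [one_smul] at h1
  rw [h1]
  by_cases hv0 : v = 0
  · simp [hv0, curlForm, killingDefect]
  obtain ⟨q₁, hq₁⟩ := (H.yRational_sprayRicci H.yRational_reducedSpray).exists_polynomial hx
    (H.unit x hx) hv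
  obtain ⟨q₂, hq₂⟩ := (H.yRational_fderiv_reducedSpray H.yRational_sprayRate).exists_polynomial hx
    (H.unit x hx) hv
  -- In dimension one `w` would be a multiple of `v ≠ 0`, contradicting `b(w) = 1` and `b(v) = 0`.
  have hn : (n : ℝ) - 1 ≠ 0 := by
    intro h0
    have hn1 : n = 1 := by
      have : (n : ℝ) = 1 := by linarith
      exact_mod_cast this
    have hfr : Module.finrank ℝ (Coord n) = 1 := by simp [hn1]
    obtain ⟨c, hc⟩ := (finrank_eq_one_iff_of_nonzero' v hv0).1 hfr (w x)
    have := H.unit x hx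
    rw [← hc] at this
    simp [hv] at this
  -- The Einstein equation on the line multiplied by `4L²`: every term except the one in `μ²` keeps
  -- a factor `L`.
  have hkey : ∀ t : ℝ, (3 * ((n : ℝ) - 1)) *
      (-((1 + h x v v * t ^ 2) * (t * curlForm b w (x, v)))
        - 2 * (-(t * curlForm b w (x, v)) + t ^ 2 * killingDefect h b w (x, v))) ^ 2 =
      (1 + h x v v * t ^ 2) * (.C 4 * (1 + .C (h x v v) * .X ^ 2) *
        (.C (σ x) * (1 + .C (h x v v) * .X ^ 2) ^ 2 - q₁)
        + .C (2 * ((n : ℝ) - 1)) * q₂ : Polynomial ℝ).eval t := fun t => by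
    have e1 := hE _ (hline t)
    rw [H.ricciCurv_eq hF (hline t), hF _ (hline t), hrate, hL, hq₁, hq₂] at e1
    simp only [hb, div_one] at e1
    have hpos : (0 : ℝ) < 1 + h x v v * t ^ 2 := by
      have := H.pos x hx v hv0
      positivity
    simp only [Polynomial.eval_mul, Polynomial.eval_add, Polynomial.eval_sub, Polynomial.eval_pow,
      Polynomial.eval_C, Polynomial.eval_X, Polynomial.eval_one]
    generalize -((1 + h x v v * t ^ 2) * (t * curlForm b w (x, v)))
        - 2 * (-(t * curlForm b w (x, v)) + t ^ 2 * killingDefect h b w (x, v)) = μ at *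
    generalize 1 + h x v v * t ^ 2 = L at *
    field_simp at e1
    linear_combination e1 / 2
  obtain ⟨hk, hr⟩ := eq_zero_of_sq_eq_mul (H.pos x hx v hv0) (mul_ne_zero three_ne_zero hn) hkey
  rw [hk, hr]
  ring

end IsUnitKropina

end Einstein

/-! ### Distortion, geodesics and S-curvature -/

section Distortion

variable {n : ℕ} {h : Coord n → Coord n →L[ℝ] Coord n →L[ℝ] ℝ} {b : Coord n → Coord n →L[ℝ] ℝ}
  {w : Coord n → Coord n} {U : Set (Coord n)} {F : Coord n × Coord n → ℝ} {p : Coord n × Coord n}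

open scoped MatrixOrder in
theorem exists_matrix_eq_transpose_mul {G : Matrix (Fin n) (Fin n) ℝ} (hG : G.PosDef) :
    ∃ M : Matrix (Fin n) (Fin n) ℝ, G = M.transpose * M := by
  obtain ⟨M, hM⟩ := CStarAlgebra.nonneg_iff_eq_star_mul_self.1 hG.posSemidef.nonneg
  exact ⟨M, by simpa [Matrix.star_eq_conjTranspose] using hM⟩

/-- The volume of an ellipsoid. -/
theorem volume_ellipsoid {B : Coord n →L[ℝ] Coord n →L[ℝ] ℝ} (hs : ∀ v z, B v z = B z v)
    (hB : ∀ v, v ≠ 0 → 0 < B v v) (u : Coord n) {r : ℝ} (hr : 0 < r) :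
    (MeasureTheory.volume {y : Coord n | B (y - u) (y - u) < r ^ 2}).toReal =
      (Real.sqrt (gramMatrix B).det)⁻¹ *
        (MeasureTheory.volume (Metric.ball (0 : Coord n) r)).toReal := by
  have hpd := gramMatrix_posDef hs hB
  obtain ⟨M, hM⟩ := exists_matrix_eq_transpose_mul hpd
  have hdet : (gramMatrix B).det = M.det ^ 2 := by
    rw [hM, Matrix.det_mul, Matrix.det_transpose, sq]
  have hM0 : M.det ≠ 0 := by
    intro h0
    have := hpd.det_pos
    simp [hdet, h0] at this
  set T : Coord n →ₗ[ℝ] Coord n := Matrix.toLpLin 2 2 M with hT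
  have hTdet : LinearMap.det T = M.det := LinearMap.det_toLpLin 2 M
  have hnorm : ∀ y : Coord n, B y y = ‖T y‖ ^ 2 := by
    intro y
    have h1 : ‖T y‖ ^ 2 = dotProduct (M.mulVec y) (M.mulVec y) := by
      rw [EuclideanSpace.norm_sq_eq]
      simp [hT, Matrix.toLpLin_apply, dotProduct, sq]
    have h2 : dotProduct (M.mulVec y) (M.mulVec y) =
        dotProduct (y : Fin n → ℝ) ((gramMatrix B).mulVec y) := by
      rw [hM, ← Matrix.mulVec_mulVec, Matrix.dotProduct_mulVec (y : Fin n → ℝ),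
        Matrix.vecMul_transpose]
    rw [h1, h2]
    simp only [dotProduct, Matrix.mulVec, gramMatrix_mulVec]
    simpa using (sum_mul_apply_single (B.flip y) y).symm
  -- With `B(y,y) = ‖Ty‖²` the ellipsoid is a linear preimage of a ball, so its volume is scaled by
  -- `1/|det T|`.
  have hset : {y : Coord n | B (y - u) (y - u) < r ^ 2} = T ⁻¹' Metric.ball (T u) r := by
    ext y
    rw [Set.mem_ofPred_eq, hnorm, Set.mem_preimage, Metric.mem_ball, dist_eq_norm, ← map_sub]
    exact pow_lt_pow_iff_left₀ (norm_nonneg _) hr.le two_ne_zero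
  rw [hset, MeasureTheory.Measure.addHaar_preimage_linearMap _ (by rw [hTdet]; exact hM0),
    MeasureTheory.Measure.addHaar_ball_center, hTdet, hdet, Real.sqrt_sq_eq_abs,
    ENNReal.toReal_mul, ENNReal.toReal_ofReal (abs_nonneg _), abs_inv]

namespace IsUnitKropina

/-- Complete the square in `h(y,y) < b(y)`, using `b(y) = h(w,y)` and `h(w,w) = 1`. The inequality
itself forces `b(y) > 0`, so the domain condition costs nothing. -/
theorem indicatrix_eq (H : IsUnitKropina U h b w)
    (hF : ∀ q ∈ posDomain U b, F q = metricSq h q / b q.1 q.2) {x : Coord n} (hx : x ∈ U) :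
    {y : Coord n | (x, y) ∈ posDomain U b ∧ F (x, y) < 1} =
      {y | h x (y - (1 / 2 : ℝ) • w x) (y - (1 / 2 : ℝ) • w x) < (1 / 2) ^ 2} := by
  ext y
  have e : h x (y - (1 / 2 : ℝ) • w x) (y - (1 / 2 : ℝ) • w x) =
      h x y y - b x y + (1 / 2) ^ 2 := by
    simp only [map_sub, map_smul, sub_apply, smul_apply, smul_eq_mul, H.symm x hx y (w x),
      H.dual x hx, H.unit x hx]
    ring
  simp only [Set.mem_ofPred_eq, e]
  constructor
  · rintro ⟨hy, hlt⟩
    have hb : 0 < b x y := hy.2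
    rw [hF _ hy, div_lt_one hb] at hlt
    simp only [metricSq] at hlt
    linarith
  · intro hlt
    have hlt' : h x y y < b x y := by linarith
    have hy0 : y ≠ 0 := by
      rintro rfl
      simp at hlt'
    have hy : (x, y) ∈ posDomain U b := ⟨hx, (H.pos x hx y hy0).trans hlt'⟩
    refine ⟨hy, ?_⟩
    rw [hF _ hy, div_lt_one hy.2]
    exact hlt'

/-- Up to an additive constant, the distortion of a Kropina metric is
`(n + 1)/2 * log (h(y,y)/b(y)²)`. -/
theorem exists_distortion_eq (H : IsUnitKropina U h b w)
    (hF : ∀ q ∈ posDomain U b, F q = metricSq h q / b q.1 q.2) :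
    ∃ C : ℝ, ∀ q ∈ posDomain U b, distortion (posDomain U b) F q =
      C + (n + 1) / 2 * (Real.log (metricSq h q) - 2 * Real.log (b q.1 q.2)) := by
  have hballpos : ∀ r : ℝ, 0 < r →
      0 < (MeasureTheory.volume (Metric.ball (0 : Coord n) r)).toReal := fun r hr =>
    ENNReal.toReal_pos (Metric.measure_ball_pos _ _ hr).ne' MeasureTheory.measure_ball_lt_top.ne
  set V := (MeasureTheory.volume (Metric.ball (0 : Coord n) 1)).toReal with hV
  set c := (MeasureTheory.volume (Metric.ball (0 : Coord n) (1 / 2))).toReal with hc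
  have hVpos : 0 < V := hballpos 1 one_pos
  have hcpos : 0 < c := hballpos (1 / 2) (by norm_num)
  refine ⟨(n * Real.log 2 - Real.log 2) / 2 - Real.log (V / c), fun q hq => ?_⟩
  have hb := hq.2
  have hL := H.metricSq_pos hq
  have hG := H.det_gramMatrix_pos hq.1
  rw [distortion, bhDensity, H.indicatrix_eq hF hq.1,
    volume_ellipsoid (H.symm _ hq.1) (H.pos _ hq.1) _ (by norm_num : (0 : ℝ) < 1 / 2),
    H.det_fundTensor hF hq, ← hV, ← hc]
  set D := (gramMatrix (h q.1)).det
  set L := metricSq h q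
  set β := b q.1 q.2
  have hsD : 0 < Real.sqrt D := Real.sqrt_pos.2 hG
  -- The factor `√det h` of the volume density cancels the one in `√det g`; this is what makes the
  -- additive constant independent of `x`.
  have e1 : V / ((Real.sqrt D)⁻¹ * c) = V / c * Real.sqrt D := by field_simp
  have e2 : (2 * L / β ^ 2) ^ n * (D * (L / (2 * β ^ 2))) =
      ((2 * L / β ^ 2) ^ n * (L / (2 * β ^ 2))) * D := by ring
  have hpos : 0 < (2 * L / β ^ 2) ^ n * (L / (2 * β ^ 2)) := by positivity
  rw [e1, e2, Real.sqrt_mul hpos.le, mul_div_mul_right _ _ hsD.ne',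
    Real.log_div (Real.sqrt_pos.2 hpos).ne' (by positivity), Real.log_sqrt hpos.le,
    Real.log_mul (by positivity) (by positivity), Real.log_pow,
    Real.log_div (by positivity) (by positivity), Real.log_div hL.ne' (by positivity),
    Real.log_mul (by positivity) hL.ne', Real.log_mul (by positivity) (by positivity),
    Real.log_pow]
  push_cast
  ring

theorem contDiffOn_kropinaSpray (H : IsUnitKropina U h b w) :
    ContDiffOn ℝ ∞ (kropinaSpray h b w) (posDomain U b) := by
  rw [contDiffOn_euclidean]
  intro i
  exact ((H.yRational_reducedSpray i).contDiffOn H.contDiffOn_form).add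
    (H.contDiffOn_sprayFactor.mul (contDiff_coord i).contDiffOn)

theorem exists_geodesic (H : IsUnitKropina U h b w)
    (hF : ∀ q ∈ posDomain U b, F q = metricSq h q / b q.1 q.2) (hp : p ∈ posDomain U b) :
    ∃ ε > 0, ∃ c : ℝ → Coord n,
      IsGeodesicOn (posDomain U b) F ε c ∧ c 0 = p.1 ∧ deriv c 0 = p.2 := by
  have hX : ContDiffAt ℝ 1
      (fun q : Coord n × Coord n => (q.2, (-2 : ℝ) • kropinaSpray h b w q)) p :=
    contDiff_snd.contDiffAt.prodMk (((H.contDiffOn_kropinaSpray.contDiffAt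
      (H.isOpen_posDomain.mem_nhds hp)).of_le (by exact_mod_cast le_top)).const_smul _)
  obtain ⟨z, hz0, δ, hδ, hz⟩ :=
    hX.exists_forall_mem_closedBall_exists_eq_forall_mem_Ioo_hasDerivAt₀ 0
  simp only [zero_sub, zero_add] at hz
  have hcont : ContinuousAt z 0 := (hz 0 ⟨by linarith, hδ⟩).continuousAt
  -- Picard–Lindelöf gives an integral curve of the vector field, which agrees with the geodesic one
  -- only inside the domain; hence the time interval is shrunk.
  have hmem : z ⁻¹' posDomain U b ∈ nhds (0 : ℝ) :=
    hcont (by rw [hz0]; exact H.isOpen_posDomain.mem_nhds hp)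
  obtain ⟨η, hη, hball⟩ := Metric.mem_nhds_iff.1 hmem
  have hfst : ∀ t ∈ Set.Ioo (-δ) δ, HasDerivAt (fun s => (z s).1) (z t).2 t := fun t ht =>
    (hasFDerivAt_fst (p := z t)).comp_hasDerivAt t (hz t ht)
  have hsnd : ∀ t ∈ Set.Ioo (-δ) δ,
      HasDerivAt (fun s => (z s).2) ((-2 : ℝ) • kropinaSpray h b w (z t)) t := fun t ht =>
    (hasFDerivAt_snd (p := z t)).comp_hasDerivAt t (hz t ht)
  refine ⟨min δ η, lt_min hδ hη, fun s => (z s).1, fun t ht => ?_, by simp [hz0], ?_⟩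
  · have ht1 : t ∈ Set.Ioo (-δ) δ :=
      ⟨by linarith [ht.1, min_le_left δ η], ht.2.trans_le (min_le_left δ η)⟩
    have ht2 : z t ∈ posDomain U b := hball (by
      rw [Metric.mem_ball, Real.dist_eq, sub_zero, abs_lt]
      exact ⟨by linarith [ht.1, min_le_right δ η], ht.2.trans_le (min_le_right δ η)⟩)
    have hd : deriv (fun s => (z s).1) t = (z t).2 := (hfst t ht1).deriv
    have hdev : deriv (fun s => (z s).1) =ᶠ[nhds t] fun s => (z s).2 :=
      Filter.eventuallyEq_of_mem (isOpen_Ioo.mem_nhds ht1) fun s hs => (hfst s hs).deriv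
    rw [hd]
    refine ⟨ht2, (hfst t ht1).differentiableAt, ?_⟩
    have e : (WithLp.toLp 2 fun i => -2 * geodCoeff F i ((z t).1, (z t).2)) =
        (-2 : ℝ) • kropinaSpray h b w (z t) := by
      ext i
      simp [H.geodCoeff_eq hF ht2]
    rw [e]
    exact (hsnd t ht1).congr_of_eventuallyEq hdev
  · rw [(hfst 0 ⟨by linarith, hδ⟩).deriv, hz0]

/-- A Kropina metric of Einstein type has vanishing S-curvature. -/
theorem hasSCurvature_zero (H : IsUnitKropina U h b w)
    (hF : ∀ q ∈ posDomain U b, F q = metricSq h q / b q.1 q.2) {σ : Coord n → ℝ}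
    (hE : ∀ q ∈ posDomain U b, ricciCurv F q = σ q.1 * F q ^ 2) (hp : p ∈ posDomain U b) :
    HasSCurvature (posDomain U b) F p 0 := by
  refine ⟨H.exists_geodesic hF hp, fun ε hε c hc hc0 hc1 => ?_⟩
  obtain ⟨C, hC⟩ := H.exists_distortion_eq hF
  obtain ⟨-, hd, hdd⟩ := hc 0 ⟨by linarith, hε⟩
  have hz0 : (c 0, deriv c 0) = p := by rw [hc0, hc1]
  rw [hz0] at hdd
  have hz : HasDerivAt (fun t => (c t, deriv c t)) (p.2, (-2 : ℝ) • kropinaSpray h b w p) 0 := by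
    convert hd.hasDerivAt.prodMk hdd using 2
    · exact hc1.symm
    · ext i
      simp [H.geodCoeff_eq hF hp]
  have hrate := H.sprayRate_eq_zero hF hE hp
  have hL : HasDerivAt (fun t => metricSq h (c t, deriv c t)) 0 0 := by
    have e1 : HasFDerivAt (metricSq h) (fderiv ℝ (metricSq h) p) (c 0, deriv c 0) := by
      rw [hz0]
      exact (H.differentiableAt H.yRational_metricSq hp).hasFDerivAt
    have e2 := e1.comp_hasDerivAt (0 : ℝ) hz
    rw [H.fderiv_metricSq_spray hp, hrate, neg_zero] at e2
    exact e2
  have hβ : HasDerivAt (fun t => b (c t) (deriv c t)) 0 0 := by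
    have e1 : HasFDerivAt (fun q : Coord n × Coord n => b q.1 q.2)
        (fderiv ℝ (fun q : Coord n × Coord n => b q.1 q.2) p) (c 0, deriv c 0) := by
      rw [hz0]
      exact (H.differentiableAt H.yRational_form hp).hasFDerivAt
    have e2 := e1.comp_hasDerivAt (0 : ℝ) hz
    rw [H.fderiv_form_spray hp, hrate, zero_mul, zero_div, neg_zero] at e2
    exact e2
  have hev : (fun t => distortion (posDomain U b) F (c t, deriv c t)) =ᶠ[nhds 0] fun t =>
      C + (n + 1) / 2 * (Real.log (metricSq h (c t, deriv c t))
        - 2 * Real.log (b (c t) (deriv c t))) :=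
    Filter.eventuallyEq_of_mem (isOpen_Ioo.mem_nhds (⟨by linarith, hε⟩ : (0 : ℝ) ∈ Set.Ioo (-ε) ε))
      fun t ht => hC _ (hc t ht).1
  have hL0 : metricSq h (c 0, deriv c 0) ≠ 0 := by
    rw [hz0]
    exact (H.metricSq_pos hp).ne'
  have hβ0 : b (c 0) (deriv c 0) ≠ 0 := by
    rw [hc0, hc1]
    exact hp.2.ne'
  refine HasDerivAt.congr_of_eventuallyEq ?_ hev
  simpa using ((((hL.log hL0).sub ((hβ.log hβ0).const_mul 2)).const_mul
    (((n : ℝ) + 1) / 2)).const_add C)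

end IsUnitKropina

end Distortion

/-! ### Normalising the one-form to unit length -/

section Normalization

variable {n : ℕ}

/-- Multiplying a Riemannian metric and a one-form by the inverse of the squared length of the
one-form does not change the Kropina metric and makes the one-form a unit form. -/
theorem isUnitKropina_normalize {V : Set (Coord n)} (hV : IsOpen V)
    {h : Coord n → Coord n →L[ℝ] Coord n →L[ℝ] ℝ} {b : Coord n → Coord n →L[ℝ] ℝ}
    (hh : ContDiffOn ℝ ∞ h V) (hb : ContDiffOn ℝ ∞ b V) (hs : ∀ x ∈ V, ∀ v z, h x v z = h x z v)
    (hpos : ∀ x ∈ V, ∀ v, v ≠ 0 → 0 < h x v v) :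
    ∃ ρ : Coord n → ℝ, ∃ w : Coord n → Coord n, (∀ x ∈ V, b x ≠ 0 → 0 < ρ x) ∧
      IsUnitKropina {x | x ∈ V ∧ b x ≠ 0} (fun x => ρ x • h x) (fun x => ρ x • b x) w := by
  set w : Coord n → Coord n := fun x => sharp (h x) (b x) with hw
  have hUV : {x | x ∈ V ∧ b x ≠ 0} ⊆ V := fun x hx => hx.1
  have hdual : ∀ x ∈ V, h x (w x) = b x := fun x hx => apply_sharp (hpos x hx) _
  have hbw : ∀ x ∈ V, b x ≠ 0 → 0 < b x (w x) := by
    intro x hx hbx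
    have hwx : w x ≠ 0 := by
      intro h0
      apply hbx
      rw [← hdual x hx, h0, map_zero]
    have := hpos x hx _ hwx
    rwa [hdual x hx] at this
  have hwc : ContDiffOn ℝ ∞ w V := contDiffOn_sharp hh hpos hb
  have hρc : ContDiffOn ℝ ∞ (fun x => (b x (w x))⁻¹) {x | x ∈ V ∧ b x ≠ 0} :=
    ((hb.clm_apply hwc).mono hUV).inv fun x hx => (hbw x hx.1 hx.2).ne'
  refine ⟨fun x => (b x (w x))⁻¹, w, fun x hx hbx => inv_pos.2 (hbw x hx hbx), ?_⟩
  refine ⟨hb.continuousOn.isOpen_inter_preimage hV isOpen_compl_singleton,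
    hρc.smul (hh.mono hUV), hρc.smul (hb.mono hUV), hwc.mono hUV, ?_, ?_, ?_, ?_⟩
  · intro x hx v z
    simp [hs x hx.1 v z]
  · intro x hx v hv
    simpa using mul_pos (inv_pos.2 (hbw x hx.1 hx.2)) (hpos x hx.1 v hv)
  · intro x hx v
    simp [hdual x hx.1]
  · intro x hx
    simpa using inv_mul_cancel₀ (hbw x hx.1 hx.2).ne'

end Normalization

/-! ### Passage from the manifold to charts -/

section Chart

variable {n : ℕ} {M : Type*} [TopologicalSpace M] [ChartedSpace (Coord n) M]
  [IsManifold (𝓡 n) ∞ M] {e : OpenPartialHomeomorph M (Coord n)}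

/-- A Riemannian metric in a chart. -/
def metricInChart (a : RiemMetric n M) (e : OpenPartialHomeomorph M (Coord n)) (x : Coord n) :
    Coord n →L[ℝ] Coord n →L[ℝ] ℝ :=
  let A : Coord n →L[ℝ] Coord n →L[ℝ] ℝ := a.inner (e.symm x)
  let T : Coord n →L[ℝ] Coord n := mfderiv (𝓡 n) (𝓡 n) e.symm x
  A.bilinearComp T T

/-- A one-form in a chart. -/
def formInChart (β : (x : M) → TangentSpace (𝓡 n) x →L[ℝ] ℝ)
    (e : OpenPartialHomeomorph M (Coord n)) (x : Coord n) : Coord n →L[ℝ] ℝ :=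
  (β (e.symm x)).comp (mfderiv (𝓡 n) (𝓡 n) e.symm x)

theorem metricInChart_symm (a : RiemMetric n M) (x v z : Coord n) :
    metricInChart a e x v z = metricInChart a e x z v := a.symm _ _ _

/-- The frame field is the image of a constant vector field under the tangent map of `e.symm`, and
both are smooth. -/
theorem contMDiffOn_frame (he : e ∈ IsManifold.maximalAtlas (𝓡 n) ∞ M) (v : Coord n) :
    ContMDiffOn (𝓡 n) (𝓡 n).tangent ∞
      (fun x => Bundle.TotalSpace.mk' (Coord n) (E := (TangentSpace (𝓡 n) : M → Type _))
        (e.symm x) (chartVector e (x, v))) e.target := by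
  have : IsManifold (𝓡 n) 1 M := .of_le (n := ∞) (by exact_mod_cast le_top)
  have hes : ContMDiffOn (𝓡 n) (𝓡 n) ∞ e.symm e.target :=
    contMDiffOn_symm_of_mem_maximalAtlas he
  have h1 := hes.contMDiffOn_tangentMapWithin (m := ∞) (by simp)
    e.open_target.uniqueMDiffOn
  have h2 : ContMDiff (𝓡 n) (𝓡 n).tangent ∞
      (fun x : Coord n => (⟨x, v⟩ : TangentBundle (𝓡 n) (Coord n))) := by
    rw [contMDiff_vectorSpace_iff_contDiff (V := fun _ => v)]
    exact contDiff_const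
  have h3 := h1.comp h2.contMDiffOn (s := e.target) fun x hx => hx
  refine h3.congr fun x hx => ?_
  simp only [Function.comp, tangentMapWithin, chartVector]
  rw [mfderivWithin_of_isOpen e.open_target hx]

theorem contDiffOn_metricInChart (a : RiemMetric n M)
    (he : e ∈ IsManifold.maximalAtlas (𝓡 n) ∞ M) :
    ContDiffOn ℝ ∞ (metricInChart a e) e.target := by
  have hes : ContMDiffOn (𝓡 n) (𝓡 n) ∞ e.symm e.target :=
    contMDiffOn_symm_of_mem_maximalAtlas he
  rw [contDiffOn_clm_apply]
  intro v
  rw [contDiffOn_clm_apply]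
  intro z x hx
  have h1 : ContMDiffWithinAt (𝓡 n) ((𝓡 n).prod 𝓘(ℝ)) ∞
      (fun x => Bundle.TotalSpace.mk' ℝ (E := Bundle.Trivial M ℝ) (e.symm x)
        (a.inner (e.symm x) (chartVector e (x, v)) (chartVector e (x, z)))) e.target x := by
    apply ContMDiffWithinAt.clm_bundle_apply₂ (F₁ := Coord n) (F₂ := Coord n)
    · exact ContMDiffAt.comp_contMDiffWithinAt x a.contMDiff.contMDiffAt (hes x hx)
    · exact contMDiffOn_frame he v x hx
    · exact contMDiffOn_frame he z x hx
  simp only [Bundle.contMDiffWithinAt_totalSpace] at h1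
  exact h1.2.contDiffWithinAt

theorem contDiffOn_formInChart {β : (x : M) → TangentSpace (𝓡 n) x →L[ℝ] ℝ}
    (hβ : IsSmoothOneForm β) (he : e ∈ IsManifold.maximalAtlas (𝓡 n) ∞ M) :
    ContDiffOn ℝ ∞ (formInChart β e) e.target := by
  have hes : ContMDiffOn (𝓡 n) (𝓡 n) ∞ e.symm e.target :=
    contMDiffOn_symm_of_mem_maximalAtlas he
  rw [contDiffOn_clm_apply]
  intro v x hx
  have h1 : ContMDiffWithinAt (𝓡 n) ((𝓡 n).prod 𝓘(ℝ)) ∞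
      (fun x => Bundle.TotalSpace.mk' ℝ (E := Bundle.Trivial M ℝ) (e.symm x)
        (β (e.symm x) (chartVector e (x, v)))) e.target x := by
    apply ContMDiffWithinAt.clm_bundle_apply (F₁ := Coord n)
    · exact ContMDiffAt.comp_contMDiffWithinAt x (ContMDiff.contMDiffAt hβ) (hes x hx)
    · exact contMDiffOn_frame he v x hx
  simp only [Bundle.contMDiffWithinAt_totalSpace] at h1
  exact h1.2.contDiffWithinAt

end Chart

theorem chartVector_ne_zero {n : ℕ} {M : Type*} [TopologicalSpace M] [ChartedSpace (Coord n) M]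
    {e : OpenPartialHomeomorph M (Coord n)} (he : e ∈ IsManifold.maximalAtlas (𝓡 n) ∞ M)
    {x v : Coord n} (hx : x ∈ e.target) (hv : v ≠ 0) : chartVector e (x, v) ≠ 0 := by
  have hmd : e.MDifferentiable (𝓡 n) (𝓡 n) :=
    ⟨(contMDiffOn_of_mem_maximalAtlas he).mdifferentiableOn (by simp),
      (contMDiffOn_symm_of_mem_maximalAtlas he).mdifferentiableOn (by simp)⟩
  have hinj := hmd.symm.mfderiv_injective (x := x) hx
  intro h0
  exact hv (hinj (h0.trans (map_zero _).symm))

theorem metricInChart_pos {n : ℕ} {M : Type*} [TopologicalSpace M] [ChartedSpace (Coord n) M]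
    [IsManifold (𝓡 n) ∞ M] {e : OpenPartialHomeomorph M (Coord n)} (a : RiemMetric n M)
    (he : e ∈ IsManifold.maximalAtlas (𝓡 n) ∞ M) {x v : Coord n}
    (hx : x ∈ e.target) (hv : v ≠ 0) : 0 < metricInChart a e x v v :=
  a.pos _ _ (chartVector_ne_zero he hx hv)

section Chart

variable {n : ℕ} {M : Type*} [TopologicalSpace M] [ChartedSpace (Coord n) M]
  {e : OpenPartialHomeomorph M (Coord n)}

theorem mem_domainInChart_iff (β : (x : M) → TangentSpace (𝓡 n) x →L[ℝ] ℝ)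
    (q : Coord n × Coord n) : q ∈ domainInChart (kropinaDomain β) e ↔
      q.1 ∈ e.target ∧ 0 < formInChart β e q.1 q.2 := Iff.rfl

/-- A vector with `β > 0` can exist only where `β ≠ 0`, so discarding the zeros of `β` and rescaling
by `ρ > 0` loses nothing. -/
theorem domainInChart_kropinaDomain (β : (x : M) → TangentSpace (𝓡 n) x →L[ℝ] ℝ)
    {ρ : Coord n → ℝ} (hρ : ∀ x ∈ e.target, formInChart β e x ≠ 0 → 0 < ρ x) :
    domainInChart (kropinaDomain β) e = posDomain {x | x ∈ e.target ∧ formInChart β e x ≠ 0}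
      (fun x => ρ x • formInChart β e x) := by
  ext q
  rw [mem_domainInChart_iff]
  constructor
  · rintro ⟨hq, hpos⟩
    have hne : formInChart β e q.1 ≠ 0 := by
      intro h0
      rw [h0] at hpos
      exact lt_irrefl _ hpos
    exact ⟨⟨hq, hne⟩, mul_pos (hρ _ hq hne) hpos⟩
  · rintro ⟨⟨hq, hne⟩, hpos⟩
    exact ⟨hq, pos_of_mul_pos_right hpos (hρ _ hq hne).le⟩

end Chart

section Chart

variable {n : ℕ} {M : Type*} [TopologicalSpace M] [ChartedSpace (Coord n) M]
  [IsManifold (𝓡 n) ∞ M] {e : OpenPartialHomeomorph M (Coord n)}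

theorem inChart_kropina (a : RiemMetric n M) (β : (x : M) → TangentSpace (𝓡 n) x →L[ℝ] ℝ)
    (q : Coord n × Coord n) : inChart (kropina a β) e q =
      metricInChart a e q.1 q.2 q.2 / formInChart β e q.1 q.2 := rfl

theorem inChart_kropina_eq (a : RiemMetric n M) (β : (x : M) → TangentSpace (𝓡 n) x →L[ℝ] ℝ)
    {ρ : Coord n → ℝ} (q : Coord n × Coord n) (hρ : ρ q.1 ≠ 0) :
    inChart (kropina a β) e q = metricSq (fun x => ρ x • metricInChart a e x) q /
      (ρ q.1 • formInChart β e q.1) q.2 := by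
  rw [inChart_kropina, metricSq]
  simp only [smul_apply, smul_eq_mul]
  rw [mul_div_mul_left _ _ hρ]

end Chart

end Finsler

end

theorem theorem1p3 {n : ℕ} {M : Type*} [TopologicalSpace M]
    [ChartedSpace (EuclideanSpace ℝ (Fin n)) M] [IsManifold (𝓡 n) ∞ M]
    (a : Finsler.RiemMetric n M) (β : (x : M) → TangentSpace (𝓡 n) x →L[ℝ] ℝ)
    (hβ : Finsler.IsSmoothOneForm β)
    (hE : Finsler.IsEinstein (Finsler.kropinaDomain β) (Finsler.kropina a β)) :
    Finsler.HasVanishingSCurvature (Finsler.kropinaDomain β) (Finsler.kropina a β) := by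
  intro e he p hp
  obtain ⟨σ, hσ⟩ := hE
  obtain ⟨ρ, w, hρ, H⟩ := Finsler.isUnitKropina_normalize e.open_target
    (Finsler.contDiffOn_metricInChart a he) (Finsler.contDiffOn_formInChart hβ he)
    (fun x _ v z => Finsler.metricInChart_symm a x v z)
    (fun x hx v hv => Finsler.metricInChart_pos a he hx hv)
  have hE' := hσ e he
  -- The normalisation changes neither the domain nor the values of `F` on it, so the local result
  -- applies with `σ` read in the chart.
  rw [Finsler.domainInChart_kropinaDomain β hρ] at hE' hp ⊢
  exact H.hasSCurvature_zero
    (fun q hq => Finsler.inChart_kropina_eq a β q (hρ _ hq.1.1 hq.1.2).ne')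
    (σ := fun x => σ (e.symm x)) hE' hp
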